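/- Let $k$ be a field, let $n\ge 2$ and let $q\in k$ be a primitive $n$-th root of unity. Let $C_n=\langle t\mid t^n=1\rangle$. The $n$-th Taft category $\mathcal T_{n,q}$ is the Hopf $k$-category over $C_n$ whose underlying $k$-category is the quotient of the free $k$-category with set of objects $C_n$ and one generating morphism $a_u:u\to tu$ for each $u\in C_n$ by the two-sided ideal generated by all compositions of $n$ generating morphisms, with comultiplication determined by $$\Delta(a_{t^i})=\sum_{t^jt^l=t^i} t^j\otimes a_{t^l}+q^l\,a_{t^j}\otimes t^l ,$$ where $t^j$ stands for the identity of the object $t^j$. A Hopf grading $X$ of $\mathcal T_{n,q}$ by an abelian group $\Gamma_X$ is a $\Gamma_X$-grading of the $k$-category such that the identities have trivial degree and the comultiplication, counit and antipode are homogeneous. It is connected if, for any two objects $x,y$, the degrees of the homogeneous walks from $x$ to $y$ (sequences of non-zero homogeneous morphisms and formal inverses of such) are all the elements of $\Gamma_X$. A morphism $X\to Y$ of connected Hopf gradings is a group homomorphism $\mu:\Gamma_X\to\Gamma_Y$ such that, for some invertible endofunctor $J$ of the Hopf $k$-category which is the identity on objects and maps $X$-homogeneous morphisms to $Y$-homogeneous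 ones, $\deg_Y J(w)=\mu(\deg_X w)$ for all $X$-homogeneous closed walks $w$ at the object $1$. A connected Hopf grading is universal if it has a unique morphism to each connected Hopf grading. The fundamental group $\Pi_1^{\mathsf H}(\mathcal T_{n,q})$ is the group of families $(\gamma_X)$ with $\gamma_X\in\Gamma_X$, where $X$ runs over the connected Hopf gradings with finite abelian grading group, such that $\mu(\gamma_X)=\gamma_Y$ for every morphism $\mu:X\to Y$. Then: 1. For every connected Hopf grading $X$ of $\mathcal T_{n,q}$, all the generating morphisms $a_u$ are homogeneous of the same degree, and $\Gamma_X$ is a finite cyclic group of order coprime to $n$. 2. There is no universal Hopf grading of $\mathcal T_{n,q}$. 3. There is an isomorphism of groups $$\Pi_1^{\mathsf H}(\mathcal T_{n,q})\;\cong\;\varprojlim_{(m,n)=1}\mathbb Z/m\mathbb Z ,$$ where the right-hand side is the subgroup of $\prod_{m\ge 1,\,(m,n)=1}\mathbb Z/m\mathbb Z$ of the families $(x_m)$ such that $x_m$ is mapped to $x_{m'}$ by the canonical projection $\mathbb Z/m\mathbb Z\to\mathbb Z/m'\mathbb Z$ whenever $m'$ divides $m$. It can be chosen such that, if $(\gamma_X)$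 corresponds to $(x_m)$, then $\gamma_X=(g^n)^{x_m}$ for each connected Hopf grading $X$ with finite group of order $m$ and common degree $g$ of the generating morphisms (so that $g^n$ is the degree of the closed walk $a_{t^{n-1}}\cdots a_t\,a_1$). -/

import Mathlib

open CategoryTheory TensorProduct

universe u w

set_option linter.unusedSectionVars false

/-- Composition of pairs of morphisms, extended bilinearly to tensor products:
`(f'' ⊗ f') ⊗ (g'' ⊗ g') ↦ (g'' ∘ f'') ⊗ (g' ∘ f')`. -/
noncomputable def tensorComp (k : Type*) [Field k] {C : Type*} [Category C] [Preadditive C]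
    [Linear k C] {a b c d e f : C} :
    ((a ⟶ c) ⊗[k] (b ⟶ d)) →ₗ[k] ((c ⟶ e) ⊗[k] (d ⟶ f)) →ₗ[k] ((a ⟶ e) ⊗[k] (b ⟶ f)) :=
  TensorProduct.map₂ (Linear.comp a c e) (Linear.comp b d f)

/-- A Hopf `k`-category over the finite group `G`: the objects of the `k`-category are the
elements of `G`.

The comultiplication `(x ⟶ y) → ⨁_{x''x' = x, y''y' = y} (x'' ⟶ y'') ⊗ (x' ⟶ y')` is given by
its components; the component with `x'' = a`, `x' = b`, `y'' = c`, `y' = d` is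
`comul hx hy` with `hx : a * b = x` and `hy : c * d = y`. -/
structure HopfStructure (k : Type*) [Field k] (G : Type*) [Group G] [Fintype G]
    [Category G] [Preadditive G] [Linear k G] where
  comul : ∀ {x y a b c d : G}, a * b = x → c * d = y →
    ((x ⟶ y) →ₗ[k] (a ⟶ c) ⊗[k] (b ⟶ d))
  comul_comp : ∀ {x y z a b c d : G} (hx : a * b = x) (hz : c * d = z) (f : x ⟶ y) (g : y ⟶ z),
    comul hx hz (f ≫ g) = ∑ y'' : G,
      tensorComp k (comul hx (mul_inv_cancel_left y'' y) f)
        (comul (mul_inv_cancel_left y'' y) hz g)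
  comul_id : ∀ {x a b : G} (h : a * b = x), comul h h (𝟙 x) = 𝟙 a ⊗ₜ[k] 𝟙 b
  comul_id_of_ne : ∀ {x a b c d : G} (h : a * b = x) (h' : c * d = x), a ≠ c →
    comul h h' (𝟙 x) = 0
  coassoc : ∀ {x y a₁ a₂ a₃ a₁₂ a₂₃ c₁ c₂ c₃ c₁₂ c₂₃ : G}
    (ha₁₂ : a₁ * a₂ = a₁₂) (ha : a₁₂ * a₃ = x) (ha₂₃ : a₂ * a₃ = a₂₃) (ha' : a₁ * a₂₃ = x)
    (hc₁₂ : c₁ * c₂ = c₁₂) (hc : c₁₂ * c₃ = y) (hc₂₃ : c₂ * c₃ = c₂₃) (hc' : c₁ * c₂₃ = y)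
    (f : x ⟶ y),
    TensorProduct.assoc k (a₁ ⟶ c₁) (a₂ ⟶ c₂) (a₃ ⟶ c₃)
        (TensorProduct.map (comul ha₁₂ hc₁₂) LinearMap.id (comul ha hc f)) =
      TensorProduct.map LinearMap.id (comul ha₂₃ hc₂₃) (comul ha' hc' f)
  /-- The counit is multiplicative, with value `1` on the identity of the object `1`, and it
  vanishes on `x ⟶ y` unless `x = 1` and `y = 1`. -/
  counit : ∀ {x y : G}, (x ⟶ y) →ₗ[k] k
  counit_comp : ∀ {x y z : G} (f : x ⟶ y) (g : y ⟶ z), counit (f ≫ g) = counit g * counit f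
  counit_id_one : counit (𝟙 (1 : G)) = 1
  counit_eq_zero : ∀ {x y : G} (f : x ⟶ y), x ≠ 1 ∨ y ≠ 1 → counit f = 0
  counit_left : ∀ {x y : G} (f : x ⟶ y),
    TensorProduct.lid k (x ⟶ y)
      (TensorProduct.map (counit (x := 1) (y := 1)) LinearMap.id
        (comul (one_mul x) (one_mul y) f)) = f
  counit_right : ∀ {x y : G} (f : x ⟶ y),
    TensorProduct.rid k (x ⟶ y)
      (TensorProduct.map LinearMap.id (counit (x := 1) (y := 1))
        (comul (mul_one x) (mul_one y) f)) = f
  /-- The antipode is a contravariant functor which is `x ↦ x⁻¹` on objects. -/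
  antipode : ∀ {x y : G}, (x ⟶ y) →ₗ[k] (y⁻¹ ⟶ x⁻¹)
  antipode_id : ∀ x : G, antipode (𝟙 x) = 𝟙 x⁻¹
  antipode_comp : ∀ {x y z : G} (f : x ⟶ y) (g : y ⟶ z),
    antipode (f ≫ g) = antipode g ≫ antipode f
  /-- `∑ S(f'') f' = ε(f)`. A summand vanishes by convention unless the target `y'` of `f'` is the
  source `y''⁻¹` of `S(f'')`, so only morphisms `f` with target `1` matter. The sum is compared
  with `ε(f)` times the sum of all identities, separately for each source `x'` and each target
  `x''⁻¹`: first for `x' = x''⁻¹`, then for `x' ≠ x''⁻¹`. -/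
  antipode_left : ∀ (a : G) (f : (1 : G) ⟶ 1),
    ∑ c : G, TensorProduct.lift ((Linear.comp a⁻¹ c⁻¹ a⁻¹).flip ∘ₗ antipode)
      (comul (mul_inv_cancel a) (mul_inv_cancel c) f) = counit f • 𝟙 a⁻¹
  antipode_left_of_ne : ∀ {x a b : G} (h : a * b = x) (f : x ⟶ 1), x ≠ 1 →
    ∑ c : G, TensorProduct.lift ((Linear.comp b c⁻¹ a⁻¹).flip ∘ₗ antipode)
      (comul h (mul_inv_cancel c) f) = 0
  /-- `∑ f'' S(f') = ε(f)`, read in the same way. -/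
  antipode_right : ∀ (d : G) (f : (1 : G) ⟶ 1),
    ∑ b : G, TensorProduct.lift ((Linear.comp d⁻¹ b⁻¹ d⁻¹).flip.compl₂ antipode)
      (comul (inv_mul_cancel b) (inv_mul_cancel d) f) = counit f • 𝟙 d⁻¹
  antipode_right_of_ne : ∀ {y c d : G} (h : c * d = y) (f : 1 ⟶ y), y ≠ 1 →
    ∑ b : G, TensorProduct.lift ((Linear.comp d⁻¹ b⁻¹ c).flip.compl₂ antipode)
      (comul (inv_mul_cancel b) h f) = 0

/-- A two-sided ideal of a `k`-category. -/
@[ext]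
structure TwoSidedIdealCat (k : Type*) [Field k] (C : Type*) [Category C] [Preadditive C]
    [Linear k C] where
  carrier : ∀ x y : C, Submodule k (x ⟶ y)
  comp_mem_left : ∀ {x y z : C} (f : x ⟶ y) (g : y ⟶ z), f ∈ carrier x y → f ≫ g ∈ carrier x z
  comp_mem_right : ∀ {x y z : C} (f : x ⟶ y) (g : y ⟶ z), g ∈ carrier y z → f ≫ g ∈ carrier x z

namespace TwoSidedIdealCat

section
variable {k : Type*} [Field k] {C : Type*} [Category C] [Preadditive C] [Linear k C]

/-- The smallest two-sided ideal containing a family of sets of morphisms. -/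
def generatedBy (k : Type*) [Field k] {C : Type*} [Category C] [Preadditive C] [Linear k C]
    (S : ∀ x y : C, Set (x ⟶ y)) : TwoSidedIdealCat k C where
  carrier x y := ⨅ J : {J : TwoSidedIdealCat k C // ∀ x y, S x y ⊆ J.carrier x y}, J.1.carrier x y
  comp_mem_left f g hf := by
    simp only [Submodule.mem_iInf] at hf ⊢
    exact fun J => J.1.comp_mem_left f g (hf J)
  comp_mem_right f g hg := by
    simp only [Submodule.mem_iInf] at hg ⊢
    exact fun J => J.1.comp_mem_right f g (hg J)

variable (I : TwoSidedIdealCat k C)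

/-- The set of objects of the quotient of a `k`-category by a two-sided ideal. -/
def Quotient (_I : TwoSidedIdealCat k C) : Type _ := C

/-- The morphism spaces of the quotient. -/
abbrev QHom (x y : C) : Type _ := (x ⟶ y) ⧸ I.carrier x y

/-- Composition in the quotient category. -/
def quotComp (x y z : C) : I.QHom x y →ₗ[k] I.QHom y z →ₗ[k] I.QHom x z :=
  Submodule.liftQ _
    (LinearMap.flip (Submodule.liftQ _
      ((Linear.comp x y z).flip.compr₂ (I.carrier x z).mkQ) (by
        intro g hg
        ext f
        simpa using I.comp_mem_right f g hg)))
    (by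
      intro f hf
      ext g
      exact (Submodule.Quotient.mk_eq_zero _).2 (I.comp_mem_left f g hf))

theorem quotComp_mk {x y z : C} (f : x ⟶ y) (g : y ⟶ z) :
    I.quotComp x y z (Submodule.Quotient.mk f) (Submodule.Quotient.mk g) =
      Submodule.Quotient.mk (f ≫ g) := rfl

theorem quotComp_assoc {w x y z : C} (f : I.QHom w x) (g : I.QHom x y) (h : I.QHom y z) :
    I.quotComp w y z (I.quotComp w x y f g) h = I.quotComp w x z f (I.quotComp x y z g h) := by
  obtain ⟨f, rfl⟩ := Submodule.Quotient.mk_surjective _ f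
  obtain ⟨g, rfl⟩ := Submodule.Quotient.mk_surjective _ g
  obtain ⟨h, rfl⟩ := Submodule.Quotient.mk_surjective _ h
  simp only [quotComp_mk, Category.assoc]

theorem quotComp_id_left {x y : C} (f : I.QHom x y) :
    I.quotComp x x y (Submodule.Quotient.mk (𝟙 x)) f = f := by
  obtain ⟨f, rfl⟩ := Submodule.Quotient.mk_surjective _ f
  simp only [quotComp_mk, Category.id_comp]

theorem quotComp_id_right {x y : C} (f : I.QHom x y) :
    I.quotComp x y y f (Submodule.Quotient.mk (𝟙 y)) = f := by
  obtain ⟨f, rfl⟩ := Submodule.Quotient.mk_surjective _ f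
  simp only [quotComp_mk, Category.comp_id]

theorem quotComp_add {x y z : C} (f : I.QHom x y) (g g' : I.QHom y z) :
    I.quotComp x y z f (g + g') = I.quotComp x y z f g + I.quotComp x y z f g' := map_add _ _ _

theorem quotComp_smul {x y z : C} (f : I.QHom x y) (r : k) (g : I.QHom y z) :
    I.quotComp x y z f (r • g) = r • I.quotComp x y z f g := map_smul _ _ _

/-- The quotient of a `k`-category by a two-sided ideal. -/
instance : Category I.Quotient where
  Hom := I.QHom
  id := fun x : C => (Submodule.Quotient.mk (𝟙 x) : I.QHom x x)
  comp {x y z} f g := I.quotComp x y z f g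
  id_comp f := I.quotComp_id_left f
  comp_id f := I.quotComp_id_right f
  assoc f g h := I.quotComp_assoc f g h

instance : Preadditive I.Quotient where
  homGroup := fun x y : C => inferInstanceAs (AddCommGroup (I.QHom x y))
  add_comp _ _ _ f f' g := LinearMap.map_add₂ (I.quotComp _ _ _) f f' g
  comp_add _ _ _ f g g' := I.quotComp_add f g g'

instance : Linear k I.Quotient where
  homModule := fun x y : C => inferInstanceAs (Module k (I.QHom x y))
  smul_comp _ _ _ r f g := LinearMap.map_smul₂ (I.quotComp _ _ _) r f g
  comp_smul _ _ _ f r g := I.quotComp_smul f r g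

/-- The projection of a `k`-category to its quotient, on morphisms. -/
def proj {x y : C} : (x ⟶ y) →ₗ[k] ((show I.Quotient from x) ⟶ (show I.Quotient from y)) :=
  (I.carrier x y).mkQ

theorem proj_surjective {x y : C} (f : (show I.Quotient from x) ⟶ (show I.Quotient from y)) :
    ∃ g : x ⟶ y, I.proj g = f :=
  Submodule.Quotient.mk_surjective _ f

theorem proj_comp {x y z : C} (f : x ⟶ y) (g : y ⟶ z) : I.proj (f ≫ g) = I.proj f ≫ I.proj g := rfl

theorem proj_id (x : C) : I.proj (𝟙 x) = 𝟙 (show I.Quotient from x) := rfl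

/-- A linear map which vanishes on the ideal induces a linear map on the quotient. -/
def liftQuot {x y : C} {M : Type*} [AddCommGroup M] [Module k M] (F : (x ⟶ y) →ₗ[k] M)
    (h : I.carrier x y ≤ LinearMap.ker F) :
    ((show I.Quotient from x) ⟶ (show I.Quotient from y)) →ₗ[k] M :=
  (I.carrier x y).liftQ F h

theorem liftQuot_proj {x y : C} {M : Type*} [AddCommGroup M] [Module k M] (F : (x ⟶ y) →ₗ[k] M)
    (h : I.carrier x y ≤ LinearMap.ker F) (f : x ⟶ y) : I.liftQuot F h (I.proj f) = F f := rfl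

theorem quot_hom_ext {x y : C} {M : Type*} [AddCommGroup M] [Module k M]
    {F F' : ((show I.Quotient from x) ⟶ (show I.Quotient from y)) →ₗ[k] M}
    (h : F ∘ₗ I.proj = F' ∘ₗ I.proj) : F = F' := by
  ext f
  obtain ⟨f, rfl⟩ := I.proj_surjective f
  exact LinearMap.congr_fun h f

theorem proj_eq_zero {x y : C} {f : x ⟶ y} (h : f ∈ I.carrier x y) : I.proj f = 0 :=
  (Submodule.Quotient.mk_eq_zero _).2 h

theorem subset_generatedBy (S : ∀ x y : C, Set (x ⟶ y)) {x y : C} {f : x ⟶ y} (h : f ∈ S x y) :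
    f ∈ (generatedBy k S).carrier x y := by
  simp only [generatedBy, Submodule.mem_iInf]
  exact fun J => J.2 x y h

theorem generatedBy_le (S : ∀ x y : C, Set (x ⟶ y)) (J : TwoSidedIdealCat k C)
    (h : ∀ x y, S x y ⊆ J.carrier x y) (x y : C) :
    (generatedBy k S).carrier x y ≤ J.carrier x y :=
  iInf_le (fun J : {J : TwoSidedIdealCat k C // ∀ x y, S x y ⊆ J.carrier x y} =>
    J.1.carrier x y) ⟨J, h⟩

end

end TwoSidedIdealCat

/-- The cyclic group `C_n = ⟨t | t ^ n = 1⟩`, seen as the set of vertices of the `n`-th crown. -/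
def Crown (n : ℕ) : Type := Multiplicative (ZMod n)

namespace Crown

instance (n : ℕ) : CommGroup (Crown n) := inferInstanceAs (CommGroup (Multiplicative (ZMod n)))
instance (n : ℕ) : DecidableEq (Crown n) := inferInstanceAs (DecidableEq (Multiplicative (ZMod n)))
instance (n : ℕ) [NeZero n] : Fintype (Crown n) :=
  inferInstanceAs (Fintype (Multiplicative (ZMod n)))

/-- The generator `t` of `C_n`. -/
def t {n : ℕ} : Crown n := Multiplicative.ofAdd (1 : ZMod n)

/-- The arrows of the crown: one arrow `a u : u → t u` for each `u ∈ C_n`. -/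
inductive Arrow {n : ℕ} : Crown n → Crown n → Type
  | a (u : Crown n) : Arrow u (t * u)

instance (n : ℕ) : Quiver (Crown n) := ⟨Arrow⟩

theorem path_target {n : ℕ} {u v : Crown n} (p : Quiver.Path u v) : t ^ p.length * u = v := by
  induction p with
  | nil => simp
  | cons p e ih =>
    have h : ∀ {b c : Crown n} (e : Arrow b c), c = t * b := fun e => by cases e; rfl
    rw [Quiver.Path.length_cons, pow_succ', mul_assoc, ih, h e]

theorem exists_path {n : ℕ} (u : Crown n) (l : ℕ) {v : Crown n} (h : t ^ l * u = v) :
    ∃ p : Quiver.Path u v, p.length = l := by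
  subst h
  induction l with
  | zero => rw [pow_zero, one_mul]; exact ⟨Quiver.Path.nil, rfl⟩
  | succ l ih =>
    obtain ⟨p, hp⟩ := ih
    rw [pow_succ', mul_assoc]
    exact ⟨p.cons (Arrow.a _), by rw [Quiver.Path.length_cons, hp]⟩

theorem arrow_eq {n : ℕ} {u u' v : Crown n} (e : Arrow u v) (e' : Arrow u' v) :
    ∃ h : u = u', h ▸ e = e' := by
  have : ∀ (w : Crown n) (f : Arrow u' w) (h : w = v), ∃ h' : u = u', h' ▸ e = h ▸ f := by
    intro w f h
    cases e
    cases f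
    obtain rfl : u' = u := mul_left_cancel h
    exact ⟨rfl, rfl⟩
  exact this v e' rfl

theorem path_unique {n : ℕ} {u v : Crown n} (p q : Quiver.Path u v) (h : p.length = q.length) :
    p = q := by
  induction p with
  | nil => 
    cases q with
    | nil => rfl
    | cons q e => simp at h
  | cons p e ih =>
    cases q with
    | nil => simp at h
    | cons q f =>
      obtain ⟨rfl, rfl⟩ := arrow_eq e f
      rw [ih q (by simpa using h)]

end Crown

/-- The `n`-th crown `k`-category: the free `k`-category on the crown. -/
abbrev CrownCategory (k : Type*) [Field k] (n : ℕ) : Type _ := Free k (Paths (Crown n))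

/-- The smallest two-sided ideal of the crown category containing all the compositions of `n`
generating morphisms. -/
noncomputable def crownIdeal (k : Type*) [Field k] (n : ℕ) : TwoSidedIdealCat k (CrownCategory k n) :=
  TwoSidedIdealCat.generatedBy k fun x y =>
    {f | ∃ p : Quiver.Path (V := Crown n) x y, p.length = n ∧
      f = (Free.embedding k (Paths (Crown n))).map p}

/-- The `k`-category underlying the `n`-th Taft category: the quotient of the `n`-th crown
`k`-category by the ideal generated by the paths of length `n`. -/
abbrev TaftCategory (k : Type*) [Field k] (n : ℕ) : Type _ := (crownIdeal k n).Quotient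

namespace TaftCategory

section
variable {k : Type*} [Field k] {n : ℕ}

instance : CommGroup (TaftCategory k n) := inferInstanceAs (CommGroup (Crown n))
instance : DecidableEq (TaftCategory k n) := inferInstanceAs (DecidableEq (Crown n))
instance [NeZero n] : Fintype (TaftCategory k n) := inferInstanceAs (Fintype (Crown n))

/-- The generator `t` of the group of objects `C_n`. -/
def t : TaftCategory k n := Crown.t (n := n)

/-- The morphism of the Taft category given by a path of the crown. -/
noncomputable def ofPath {x y : TaftCategory k n} (p : Quiver.Path (V := Crown n) x y) : x ⟶ y :=
  (crownIdeal k n).proj ((Free.embedding k (Paths (Crown n))).map p)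

/-- The generating morphism `a_u : u → t u` of the Taft category. -/
noncomputable def gen (u : TaftCategory k n) : u ⟶ t * u :=
  ofPath (Quiver.Hom.toPath (V := Crown n) (Crown.Arrow.a (n := n) u))

/-- The morphism from `u` to `v` given by the path of length `l`, or zero if there is no such
path. -/
noncomputable def E (u v : TaftCategory k n) (l : ℕ) : u ⟶ v :=
  open Classical in
  if h : ∃ p : Quiver.Path (V := Crown n) u v, p.length = l then ofPath h.choose else 0

theorem E_length {u v : TaftCategory k n} (p : Quiver.Path (V := Crown n) u v) :
    E u v p.length = ofPath p := by
  have h : ∃ q : Quiver.Path (V := Crown n) u v, q.length = p.length := ⟨p, rfl⟩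
  rw [E, dif_pos h, Crown.path_unique _ _ h.choose_spec]

theorem exists_path {u v : TaftCategory k n} {l : ℕ} (h : t ^ l * u = v) :
    ∃ p : Quiver.Path (V := Crown n) u v, p.length = l := Crown.exists_path (n := n) u l h

theorem path_target {u v : TaftCategory k n} (p : Quiver.Path (V := Crown n) u v) :
    t ^ p.length * u = v := Crown.path_target p

theorem E_of_ne {u v : TaftCategory k n} {l : ℕ} (h : t ^ l * u ≠ v) : E u v l = 0 := by
  rw [E, dif_neg]
  rintro ⟨p, rfl⟩
  exact h (path_target p)

theorem ofPath_comp {u v w : TaftCategory k n} (p : Quiver.Path (V := Crown n) u v)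
    (q : Quiver.Path (V := Crown n) v w) : ofPath (k := k) p ≫ ofPath q = ofPath (p.comp q) := 
  ((crownIdeal k n).proj_comp _ _).symm.trans
    (congrArg (crownIdeal k n).proj ((Free.embedding k (Paths (Crown n))).map_comp p q).symm)

theorem E_comp (u v w : TaftCategory k n) (l m : ℕ) :
    E u v l ≫ E v w m = if t ^ l * u = v then E u w (l + m) else 0 := by
  split_ifs with h
  · by_cases h' : t ^ m * v = w
    · obtain ⟨p, rfl⟩ := exists_path h
      obtain ⟨q, rfl⟩ := exists_path h'
      rw [E_length, E_length, ofPath_comp]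
      exact (E_length (p.comp q)).symm.trans
        (congrArg (E u w) (Quiver.Path.length_comp p q))
    · rw [E_of_ne h', Limits.comp_zero]
      refine (E_of_ne ?_).symm
      rw [add_comm, pow_add, mul_assoc, h]
      exact h'
  · rw [E_of_ne h, Limits.zero_comp]

theorem E_zero_self (u : TaftCategory k n) : E u u 0 = 𝟙 u := by
  have := E_length (k := k) (Quiver.Path.nil (V := Crown n) (a := u))
  exact this.trans rfl

theorem gen_eq (u : TaftCategory k n) : gen u = E u (t * u) 1 :=
  (E_length (Quiver.Hom.toPath (V := Crown n) (Crown.Arrow.a (n := n) u))).symm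

theorem E_self (u v : TaftCategory k n) : E u v n = 0 := by
  by_cases h : t ^ n * u = v
  · obtain ⟨p, hp⟩ := exists_path h
    refine ((congrArg (E u v) hp).symm.trans (E_length p)).trans ?_
    exact TwoSidedIdealCat.proj_eq_zero _ (TwoSidedIdealCat.subset_generatedBy _ ⟨p, hp, rfl⟩)
  · exact E_of_ne h

theorem E_of_le (u v : TaftCategory k n) {l : ℕ} (h : n ≤ l) : E u v l = 0 := by
  obtain ⟨m, rfl⟩ := Nat.exists_eq_add_of_le h
  have := E_comp u (t ^ n * u) v n m
  rw [if_pos rfl, E_self, Limits.zero_comp] at this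
  exact this.symm

/-- A path of the crown, as a morphism of the crown category. -/
noncomputable def freePath (k : Type*) [Field k] {n : ℕ} {x y : Crown n} (p : Quiver.Path x y) :
    @Quiver.Hom (CrownCategory k n) _ x y :=
  (Free.embedding k (Paths (Crown n))).map p

theorem freePath_comp {x y z : Crown n} (p : Quiver.Path x y) (q : Quiver.Path y z) :
    freePath k p ≫ freePath k q = freePath k (p.comp q) :=
  ((Free.embedding k (Paths (Crown n))).map_comp p q).symm

theorem mem_span_freePath {x y : CrownCategory k n} (f : x ⟶ y) :
    f ∈ Submodule.span k (Set.range fun p : Quiver.Path (V := Crown n) x y => freePath k p) := by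
  have h : ∀ f : Quiver.Path (V := Crown n) x y →₀ k,
      (show x ⟶ y from f) ∈ Submodule.span k
        (Set.range fun p : Quiver.Path (V := Crown n) x y => freePath k p) := by
    intro f
    induction f using Finsupp.induction_linear with
    | zero => exact zero_mem _
    | add g g' h h' => exact add_mem h h'
    | single q r =>
      have : (show x ⟶ y from Finsupp.single q r) = r • freePath k q :=
        (Finsupp.smul_single_one q r).symm
      rw [this]
      exact Submodule.smul_mem _ r (Submodule.subset_span ⟨q, rfl⟩)
  exact h f

theorem free_hom_ext {M : Type*} [AddCommGroup M] [Module k M] {x y : CrownCategory k n}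
    {F F' : (x ⟶ y) →ₗ[k] M} (h : ∀ p : Quiver.Path (V := Crown n) x y,
      F (freePath k p) = F' (freePath k p)) : F = F' := by
  refine LinearMap.ext fun f => LinearMap.eqOn_span
    (s := Set.range fun p : Quiver.Path (V := Crown n) x y => freePath k p) ?_
    (mem_span_freePath f)
  rintro _ ⟨p, rfl⟩
  exact h p

/-- The ideal of linear combinations of paths of length at least `n`. -/
noncomputable def longIdeal (k : Type*) [Field k] (n : ℕ) :
    TwoSidedIdealCat k (CrownCategory k n) where
  carrier x y := Submodule.span k {f | ∃ p : Quiver.Path (V := Crown n) x y, n ≤ p.length ∧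
      f = freePath k p}
  comp_mem_left {x y z} f g hf := by
    induction hf using Submodule.span_induction with
    | zero => rw [Limits.zero_comp]; exact zero_mem _
    | add f f' _ _ h h' => rw [Preadditive.add_comp]; exact add_mem h h'
    | smul r f _ h => rw [Linear.smul_comp]; exact Submodule.smul_mem _ r h
    | mem f hf =>
      obtain ⟨p, hp, rfl⟩ := hf
      induction mem_span_freePath g using Submodule.span_induction with
      | zero => rw [Limits.comp_zero]; exact zero_mem _
      | add f f' _ _ h h' => rw [Preadditive.comp_add]; exact add_mem h h'
      | smul r f _ h => rw [Linear.comp_smul]; exact Submodule.smul_mem _ r h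
      | mem g hg =>
        obtain ⟨q, rfl⟩ := hg
        exact Submodule.subset_span ⟨p.comp q,
          (hp.trans (Nat.le_add_right _ _)).trans_eq (Quiver.Path.length_comp p q).symm,
          freePath_comp p q⟩
  comp_mem_right {x y z} f g hg := by
    induction hg using Submodule.span_induction with
    | zero => rw [Limits.comp_zero]; exact zero_mem _
    | add f f' _ _ h h' => rw [Preadditive.comp_add]; exact add_mem h h'
    | smul r f _ h => rw [Linear.comp_smul]; exact Submodule.smul_mem _ r h
    | mem g hg =>
      obtain ⟨q, hq, rfl⟩ := hg
      induction mem_span_freePath f using Submodule.span_induction with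
      | zero => rw [Limits.zero_comp]; exact zero_mem _
      | add f f' _ _ h h' => rw [Preadditive.add_comp]; exact add_mem h h'
      | smul r f _ h => rw [Linear.smul_comp]; exact Submodule.smul_mem _ r h
      | mem g hg =>
        obtain ⟨p, rfl⟩ := hg
        exact Submodule.subset_span ⟨p.comp q,
          (hq.trans (Nat.le_add_left _ _)).trans_eq (Quiver.Path.length_comp p q).symm,
          freePath_comp p q⟩

/-- The linear map on a morphism space of the crown category with value `φ l` on the path of
length `l`. -/
noncomputable def freeLift {M : Type*} [AddCommGroup M] [Module k M] (x y : CrownCategory k n)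
    (φ : ℕ → M) : (x ⟶ y) →ₗ[k] M :=
  Finsupp.linearCombination k fun p : Quiver.Path (V := Crown n) x y => φ p.length

theorem freeLift_freePath {M : Type*} [AddCommGroup M] [Module k M] (x y : CrownCategory k n)
    (φ : ℕ → M) (p : Quiver.Path (V := Crown n) x y) :
    freeLift (k := k) x y φ (freePath k p) = φ p.length := by
  have := Finsupp.linearCombination_single k (v := fun p : Quiver.Path (V := Crown n) x y =>
    φ p.length) (1 : k) p
  rw [one_smul] at this
  exact this

theorem crownIdeal_le (x y : CrownCategory k n) {M : Type*} [AddCommGroup M] [Module k M]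
    (φ : ℕ → M) (hφ : ∀ l, n ≤ l → φ l = 0) :
    (crownIdeal k n).carrier x y ≤ LinearMap.ker (freeLift (k := k) x y φ) := by
  refine (TwoSidedIdealCat.generatedBy_le _ (longIdeal k n) ?_ x y).trans ?_
  · rintro x y f ⟨p, hp, rfl⟩
    exact Submodule.subset_span ⟨p, hp.ge, rfl⟩
  · refine Submodule.span_le.2 ?_
    rintro f ⟨p, hp, rfl⟩
    exact (freeLift_freePath x y φ p).trans (hφ _ hp)

/-- The linear map on a morphism space of the Taft category with value `φ l` on the path of
length `l`; here `φ` has to vanish from `n` on. -/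
noncomputable def lift {M : Type*} [AddCommGroup M] [Module k M] (x y : TaftCategory k n)
    (φ : ℕ → M) (hφ : ∀ l, n ≤ l → φ l = 0) : (x ⟶ y) →ₗ[k] M :=
  (crownIdeal k n).liftQuot (freeLift (k := k) (n := n) x y φ) (crownIdeal_le x y φ hφ)

theorem lift_E {M : Type*} [AddCommGroup M] [Module k M] (x y : TaftCategory k n)
    (φ : ℕ → M) (hφ : ∀ l, n ≤ l → φ l = 0) {l : ℕ} (h : t ^ l * x = y) :
    lift x y φ hφ (E x y l) = φ l := by
  obtain ⟨p, rfl⟩ := exists_path h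
  rw [E_length]
  exact ((crownIdeal k n).liftQuot_proj _ (crownIdeal_le x y φ hφ) _).trans
    (freeLift_freePath (k := k) (n := n) x y φ p)

/-- Two linear maps agree if they agree on all paths. -/
theorem hom_ext {M : Type*} [AddCommGroup M] [Module k M] {x y : TaftCategory k n}
    {F F' : (x ⟶ y) →ₗ[k] M} (h : ∀ l, t ^ l * x = y → F (E x y l) = F' (E x y l)) : F = F' := by
  refine (crownIdeal k n).quot_hom_ext (free_hom_ext (n := n) fun p => ?_)
  have := h p.length (path_target p)
  rw [E_length] at this
  exact this

end

section
variable {k : Type*} [Field k] {n : ℕ}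

theorem span_E (x y : TaftCategory k n) : Submodule.span k (Set.range (E x y)) = ⊤ := by
  rw [← Submodule.ker_mkQ (Submodule.span k (Set.range (E x y))), LinearMap.ker_eq_top]
  refine hom_ext fun l _ => ?_
  rw [LinearMap.zero_apply, Submodule.mkQ_apply, Submodule.Quotient.mk_eq_zero]
  exact Submodule.subset_span ⟨l, rfl⟩

theorem hom_ind {x y : TaftCategory k n} {P : (x ⟶ y) → Prop}
    (hE : ∀ l, t ^ l * x = y → P (E x y l)) (h0 : P 0) (hadd : ∀ f g, P f → P g → P (f + g))
    (hsmul : ∀ (r : k) f, P f → P (r • f)) (f : x ⟶ y) : P f := by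
  have hf : f ∈ Submodule.span k (Set.range (E x y)) := by rw [span_E]; trivial
  induction hf using Submodule.span_induction with
  | zero => exact h0
  | add f g _ _ hf hg => exact hadd f g hf hg
  | smul r f _ hf => exact hsmul r f hf
  | mem f hf =>
    obtain ⟨l, rfl⟩ := hf
    by_cases h : t ^ l * x = y
    · exact hE l h
    · rw [E_of_ne h]; exact h0

/-- The character of `C_n` with value `q` at `t`, that is `t ^ i ↦ q ^ i`. -/
def chi (q : k) (u : TaftCategory k n) : k :=
  q ^ (Multiplicative.toAdd (show Multiplicative (ZMod n) from u)).val

theorem chi_one (q : k) : chi q (1 : TaftCategory k n) = 1 := by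
  have : chi q (1 : TaftCategory k n) = q ^ (0 : ZMod n).val := rfl
  rw [this, ZMod.val_zero, pow_zero]

theorem chi_mul [NeZero n] {q : k} (hq : q ^ n = 1) (u v : TaftCategory k n) :
    chi q (u * v) = chi q u * chi q v := by
  have : ∀ a b : ZMod n, q ^ (a + b).val = q ^ a.val * q ^ b.val := by
    intro a b
    rw [ZMod.val_add, ← pow_add, ← pow_eq_pow_mod _ hq]
  exact this _ _

theorem chi_t {q : k} (hq : q ^ n = 1) : chi q (t : TaftCategory k n) = q := by
  have : chi q (t : TaftCategory k n) = q ^ (1 : ZMod n).val := rfl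
  rw [this, ZMod.val_one_eq_one_mod, ← pow_eq_pow_mod _ hq, pow_one]

theorem t_mul_ne (hn : 2 ≤ n) (u : TaftCategory k n) : t * u ≠ u := by
  intro h
  have h1 : (t : TaftCategory k n) = 1 := mul_eq_right.1 h
  have : Fact (1 < n) := ⟨hn⟩
  exact one_ne_zero (α := ZMod n) h1

/-- Precomposition with the generating morphism `u → t u`. -/
noncomputable def L (u v : TaftCategory k n) : (t * u ⟶ v) →ₗ[k] (u ⟶ v) :=
  Linear.leftComp k v (E u (t * u) 1)

/-- Postcomposition with the generating morphism `t⁻¹ v → v`. -/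
noncomputable def R (u v : TaftCategory k n) : (u ⟶ t⁻¹ * v) →ₗ[k] (u ⟶ v) :=
  Linear.rightComp k u (E (t⁻¹ * v) v 1)

theorem L_E (u v : TaftCategory k n) (l : ℕ) : L u v (E (t * u) v l) = E u v (l + 1) := by
  have := E_comp u (t * u) v 1 l
  rw [if_pos (by rw [pow_one]), add_comm] at this
  exact this

theorem R_E (u v : TaftCategory k n) (l : ℕ) : R u v (E u (t⁻¹ * v) l) = E u v (l + 1) := by
  refine (E_comp u (t⁻¹ * v) v l 1).trans ?_
  split_ifs with h
  · rfl
  · refine (E_of_ne fun h' => h ?_).symm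
    rw [← h', pow_succ', mul_assoc, inv_mul_cancel_left]

theorem L_R (u v : TaftCategory k n) (f : t * u ⟶ t⁻¹ * v) : L u v (R (t * u) v f) =
    R u v (L u (t⁻¹ * v) f) :=
  (Category.assoc (E u (t * u) 1) f (E (t⁻¹ * v) v 1)).symm

/-- The comultiplication of the path of length `l` from `a * b`, in the component
`(a ⟶ c) ⊗ (b ⟶ d)`; it is obtained by multiplying out the comultiplications of the generating
morphisms. -/
noncomputable def delta (q : k) : ℕ → ∀ a b c d : TaftCategory k n, (a ⟶ c) ⊗[k] (b ⟶ d)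
  | 0, a, b, c, d => E a c 0 ⊗ₜ[k] E b d 0
  | l + 1, a, b, c, d => TensorProduct.map LinearMap.id (L b d) (delta q l a (t * b) c d) +
      chi q b • TensorProduct.map (L a c) LinearMap.id (delta q l (t * a) b c d)

theorem delta_zero (q : k) (a b c d : TaftCategory k n) :
    delta q 0 a b c d = E a c 0 ⊗ₜ[k] E b d 0 := rfl

theorem delta_succ (q : k) (l : ℕ) (a b c d : TaftCategory k n) :
    delta q (l + 1) a b c d =
      TensorProduct.map LinearMap.id (L b d) (delta q l a (t * b) c d) +
      chi q b • TensorProduct.map (L a c) LinearMap.id (delta q l (t * a) b c d) := rfl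

theorem delta_of_ne (q : k) (l : ℕ) (a b c d : TaftCategory k n) (h : t ^ l * (a * b) ≠ c * d) :
    delta q l a b c d = 0 := by
  induction l generalizing a b with
  | zero =>
    rw [delta_zero]
    by_cases h1 : t ^ 0 * a = c
    · by_cases h2 : t ^ 0 * b = d
      · simp only [pow_zero, one_mul] at h h1 h2
        exact absurd (by rw [h1, h2]) h
      · rw [E_of_ne h2, tmul_zero]
    · rw [E_of_ne h1, zero_tmul]
  | succ l ih =>
    rw [delta_succ, ih, ih, map_zero, map_zero, smul_zero, add_zero]
    · rwa [mul_assoc t, ← mul_assoc (t ^ l) t, ← pow_succ]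
    · rwa [mul_left_comm a, ← mul_assoc (t ^ l) t, ← pow_succ]

/-- The Gaussian binomial coefficients. -/
def gaussBinom (q : k) : ℕ → ℕ → k
  | _, 0 => 1
  | 0, _ + 1 => 0
  | l + 1, i + 1 => q ^ (i + 1) * gaussBinom q l (i + 1) + gaussBinom q l i

theorem gaussBinom_succ (q : k) (l i : ℕ) : gaussBinom q (l + 1) (i + 1) =
    q ^ (i + 1) * gaussBinom q l (i + 1) + gaussBinom q l i := by
  rw [gaussBinom]

theorem gaussBinom_zero_right (q : k) (l : ℕ) : gaussBinom q l 0 = 1 := by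
  cases l <;> rw [gaussBinom]

theorem gaussBinom_of_lt (q : k) (l i : ℕ) (h : l < i) : gaussBinom q l i = 0 := by
  induction l generalizing i with
  | zero =>
    obtain ⟨i, rfl⟩ := Nat.exists_eq_succ_of_ne_zero h.ne'
    rw [Nat.succ_eq_add_one, gaussBinom]
  | succ l ih =>
    obtain ⟨i, rfl⟩ := Nat.exists_eq_succ_of_ne_zero (Nat.ne_zero_of_lt h)
    rw [Nat.succ_eq_add_one, gaussBinom_succ, ih _ (by omega), ih _ (by omega), mul_zero, add_zero]

theorem gaussBinom_mul (q : k) (l i : ℕ) :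
    gaussBinom q (l + 1) (i + 1) * (q ^ (i + 1) - 1) = gaussBinom q l i * (q ^ (l + 1) - 1) := by
  induction l generalizing i with
  | zero =>
    cases i with
    | zero => simp [gaussBinom]
    | succ i => simp [gaussBinom]
  | succ l ih =>
    have h1 := ih i
    rw [gaussBinom_succ q (l + 1) i]
    cases i with
    | zero =>
      rw [gaussBinom_zero_right] at h1 ⊢
      linear_combination q * h1
    | succ i =>
      have h2 := ih i
      have h3 := gaussBinom_succ q l i
      linear_combination q ^ (i + 2) * h1 + q * h2 - q * (q ^ (l + 1) - 1) * h3

theorem gaussBinom_eq_zero {q : k} (hq : IsPrimitiveRoot q n) {i : ℕ} (h0 : 0 < i) (hi : i < n) :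
    gaussBinom q n i = 0 := by
  obtain ⟨i, rfl⟩ := Nat.exists_eq_succ_of_ne_zero h0.ne'
  obtain ⟨m, rfl⟩ := Nat.exists_eq_succ_of_ne_zero (Nat.ne_zero_of_lt hi)
  have h := gaussBinom_mul q m i
  rw [hq.pow_eq_one, sub_self, mul_zero, mul_eq_zero] at h
  exact h.resolve_right (sub_ne_zero.2 (hq.pow_ne_one_of_pos_of_lt h0.ne' hi))

theorem delta_eq_sum [NeZero n] {q : k} (hq : q ^ n = 1) (l : ℕ) (a b c d : TaftCategory k n) :
    delta q l a b c d = ∑ i ∈ Finset.range (l + 1),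
      (gaussBinom q l i * chi q b ^ i) • (E a c i ⊗ₜ[k] E b d (l - i)) := by
  induction l generalizing a b with
  | zero => simp [delta_zero, gaussBinom]
  | succ l ih =>
    have h1 : TensorProduct.map LinearMap.id (L b d) (delta q l a (t * b) c d) =
        ∑ i ∈ Finset.range (l + 2),
          (q ^ i * gaussBinom q l i * chi q b ^ i) • (E a c i ⊗ₜ[k] E b d (l + 1 - i)) := by
      rw [Finset.sum_range_succ, gaussBinom_of_lt q l (l + 1) (by omega), mul_zero, zero_mul,
        zero_smul, add_zero, ih, map_sum]
      refine Finset.sum_congr rfl fun i hi => ?_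
      rw [map_smul, map_tmul, L_E, LinearMap.id_apply, chi_mul hq, chi_t hq,
        Nat.sub_add_comm (by rw [Finset.mem_range] at hi; omega)]
      congr 1
      ring
    have h2 : chi q b • TensorProduct.map (L a c) LinearMap.id (delta q l (t * a) b c d) =
        ∑ i ∈ Finset.range (l + 1),
          (gaussBinom q l i * chi q b ^ (i + 1)) • (E a c (i + 1) ⊗ₜ[k] E b d (l - i)) := by
      rw [ih, map_sum, Finset.smul_sum]
      refine Finset.sum_congr rfl fun i _ => ?_
      rw [map_smul, map_tmul, L_E, LinearMap.id_apply, smul_smul]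
      congr 1
      ring
    rw [delta_succ, h1, h2, Finset.sum_range_succ', Finset.sum_range_succ' _ (l + 1), add_right_comm,
      ← Finset.sum_add_distrib]
    congr 1
    · refine Finset.sum_congr rfl fun i _ => ?_
      rw [Nat.add_sub_add_right, ← add_smul, gaussBinom_succ]
      congr 1
      ring
    · simp only [gaussBinom_zero_right, pow_zero, one_mul]

theorem delta_of_le [NeZero n] {q : k} (hq : IsPrimitiveRoot q n) (l : ℕ) (h : n ≤ l)
    (a b c d : TaftCategory k n) : delta q l a b c d = 0 := by
  induction l, h using Nat.le_induction generalizing a b with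
  | base =>
    rw [delta_eq_sum hq.pow_eq_one]
    refine Finset.sum_eq_zero fun i hi => ?_
    rw [Finset.mem_range] at hi
    rcases Nat.eq_zero_or_pos i with rfl | h0
    · rw [Nat.sub_zero, E_self, tmul_zero, smul_zero]
    · rcases (Nat.lt_succ_iff.1 hi).eq_or_lt with rfl | hi
      · rw [E_self, zero_tmul, smul_zero]
      · rw [gaussBinom_eq_zero hq h0 hi, zero_mul, zero_smul]
  | succ l _ ih => rw [delta_succ, ih, ih, map_zero, map_zero, smul_zero, add_zero]

theorem tensorComp_tmul {a b c d e f : TaftCategory k n} (p : a ⟶ c) (r : b ⟶ d) (p' : c ⟶ e)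
    (r' : d ⟶ f) : tensorComp k (p ⊗ₜ r) (p' ⊗ₜ r') = (p ≫ p') ⊗ₜ[k] (r ≫ r') := rfl

theorem tensorComp_L_right {a b c d e f : TaftCategory k n} (z : (a ⟶ c) ⊗[k] (t * b ⟶ d))
    (w : (c ⟶ e) ⊗[k] (d ⟶ f)) :
    tensorComp k (TensorProduct.map LinearMap.id (L b d) z) w =
      TensorProduct.map LinearMap.id (L b f) (tensorComp k z w) := by
  induction z with
  | zero => simp only [map_zero, LinearMap.zero_apply]
  | add z z' h h' => simp only [map_add, LinearMap.add_apply, h, h']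
  | tmul p r =>
    induction w with
    | zero => simp only [map_zero]
    | add w w' h h' => simp only [map_add, h, h']
    | tmul p' r' =>
      rw [tensorComp_tmul, map_tmul, map_tmul, tensorComp_tmul]
      exact congrArg _ (Category.assoc _ _ _)

theorem tensorComp_L_left {a b c d e f : TaftCategory k n} (z : (t * a ⟶ c) ⊗[k] (b ⟶ d))
    (w : (c ⟶ e) ⊗[k] (d ⟶ f)) :
    tensorComp k (TensorProduct.map (L a c) LinearMap.id z) w =
      TensorProduct.map (L a e) LinearMap.id (tensorComp k z w) := by
  induction z with
  | zero => simp only [map_zero, LinearMap.zero_apply]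
  | add z z' h h' => simp only [map_add, LinearMap.add_apply, h, h']
  | tmul p r =>
    induction w with
    | zero => simp only [map_zero]
    | add w w' h h' => simp only [map_add, h, h']
    | tmul p' r' =>
      rw [tensorComp_tmul, map_tmul, map_tmul, tensorComp_tmul]
      exact congrArg (· ⊗ₜ[k] _) (Category.assoc _ _ _)

theorem delta_add [NeZero n] (q : k) (l m : ℕ) (a b e f : TaftCategory k n) :
    delta q (l + m) a b e f = ∑ c : TaftCategory k n, ∑ d : TaftCategory k n,
      tensorComp k (delta q l a b c d) (delta q m c d e f) := by
  induction l generalizing a b with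
  | zero =>
    rw [Finset.sum_eq_single a, Finset.sum_eq_single b]
    · rw [delta_zero, E_zero_self, E_zero_self, Nat.zero_add]
      induction delta q m a b e f with
      | zero => rw [map_zero]
      | add w w' h h' => rw [map_add, ← h, ← h']
      | tmul p r => rw [tensorComp_tmul, Category.id_comp, Category.id_comp]
    · intro d _ hd
      rw [delta_zero, E_of_ne (v := d) (by rw [pow_zero, one_mul]; exact hd.symm), tmul_zero,
        map_zero, LinearMap.zero_apply]
    · intro h; exact absurd (Finset.mem_univ _) h
    · intro c _ hc
      refine Finset.sum_eq_zero fun d _ => ?_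
      rw [delta_zero, E_of_ne (v := c) (by rw [pow_zero, one_mul]; exact hc.symm), zero_tmul,
        map_zero, LinearMap.zero_apply]
    · intro h; exact absurd (Finset.mem_univ _) h
  | succ l ih =>
    rw [add_right_comm, delta_succ, ih, ih]
    simp only [delta_succ q l, map_sum, Finset.smul_sum, ← Finset.sum_add_distrib, map_add,
      map_smul, LinearMap.add_apply, LinearMap.smul_apply, tensorComp_L_left, tensorComp_L_right]

theorem delta_succ' (q : k) (l : ℕ) (a b e f : TaftCategory k n) :
    delta q (l + 1) a b e f =
      TensorProduct.map LinearMap.id (R b f) (delta q l a b e (t⁻¹ * f)) +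
      chi q f • TensorProduct.map (R a e) LinearMap.id (delta q l a b (t⁻¹ * e) f) := by
  induction l generalizing a b with
  | zero =>
    rw [delta_succ]
    simp only [delta_zero, map_tmul, L_E, R_E, LinearMap.id_apply]
    congr 1
    by_cases h : t ^ 0 * b = f
    · rw [pow_zero, one_mul] at h
      rw [h]
    · rw [E_of_ne h, tmul_zero, smul_zero, smul_zero]
  | succ l ih =>
    rw [delta_succ, ih, ih, delta_succ, delta_succ]
    simp only [map_add, map_smul, smul_add, smul_smul, ← LinearMap.comp_apply,
      ← TensorProduct.map_comp, LinearMap.comp_id, LinearMap.id_comp]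
    have h1 : L b f ∘ₗ R (t * b) f = R b f ∘ₗ L b (t⁻¹ * f) := LinearMap.ext (L_R b f)
    have h2 : L a e ∘ₗ R (t * a) e = R a e ∘ₗ L a (t⁻¹ * e) := LinearMap.ext (L_R a e)
    rw [h1, h2, mul_comm (chi q b)]
    abel

end

section
variable {k : Type*} [Field k] {n : ℕ} [NeZero n] {q : k}

/-- The comultiplication of the Taft category. -/
noncomputable def comul (hq : IsPrimitiveRoot q n) {x y a b c d : TaftCategory k n}
    (_hx : a * b = x) (_hy : c * d = y) : (x ⟶ y) →ₗ[k] (a ⟶ c) ⊗[k] (b ⟶ d) :=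
  lift x y (fun l => delta q l a b c d) fun l hl => delta_of_le hq l hl a b c d

theorem comul_E (hq : IsPrimitiveRoot q n) {x y a b c d : TaftCategory k n}
    (hx : a * b = x) (hy : c * d = y) (l : ℕ) :
    comul hq hx hy (E x y l) = delta q l a b c d := by
  by_cases h : t ^ l * x = y
  · exact lift_E x y _ _ h
  · rw [E_of_ne h, map_zero, delta_of_ne]
    rwa [hx, hy]

theorem comul_comp (hq : IsPrimitiveRoot q n) {x y z a b c d : TaftCategory k n}
    (hx : a * b = x) (hz : c * d = z) (f : x ⟶ y) (g : y ⟶ z) :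
    comul hq hx hz (f ≫ g) = ∑ u : TaftCategory k n,
      tensorComp k (comul hq hx (mul_inv_cancel_left u y) f)
        (comul hq (mul_inv_cancel_left u y) hz g) := by
  induction f using hom_ind with
  | h0 => simp only [Limits.zero_comp, map_zero, LinearMap.zero_apply, Finset.sum_const_zero]
  | hadd f f' h h' =>
    simp only [Preadditive.add_comp, map_add, LinearMap.add_apply, Finset.sum_add_distrib, h, h']
  | hsmul r f h =>
    simp only [Linear.smul_comp, map_smul, LinearMap.smul_apply, ← Finset.smul_sum, h]
  | hE l hl =>
  induction g using hom_ind with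
  | h0 => simp only [Limits.comp_zero, map_zero, Finset.sum_const_zero]
  | hadd f f' h h' =>
    simp only [Preadditive.comp_add, map_add, Finset.sum_add_distrib, h, h']
  | hsmul r f h =>
    simp only [Linear.comp_smul, map_smul, ← Finset.smul_sum, h]
  | hE m hm =>
  rw [E_comp, if_pos hl, comul_E, delta_add]
  refine Finset.sum_congr rfl fun u _ => ?_
  rw [Finset.sum_eq_single (u⁻¹ * y), comul_E, comul_E]
  · intro v _ hv
    rw [delta_of_ne q l a b u v, map_zero, LinearMap.zero_apply]
    rw [hx, hl]
    rintro rfl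
    exact hv (inv_mul_cancel_left u v).symm
  · intro h; exact absurd (Finset.mem_univ _) h

theorem comul_id (hq : IsPrimitiveRoot q n) {x a b : TaftCategory k n} (h : a * b = x) :
    comul hq h h (𝟙 x) = 𝟙 a ⊗ₜ[k] 𝟙 b := by
  rw [← E_zero_self, comul_E, delta_zero, E_zero_self, E_zero_self]

theorem comul_id_of_ne (hq : IsPrimitiveRoot q n) {x a b c d : TaftCategory k n} (h : a * b = x)
    (h' : c * d = x) (hac : a ≠ c) : comul hq h h' (𝟙 x) = 0 := by
  rw [← E_zero_self, comul_E, delta_zero, E_of_ne, zero_tmul]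
  rwa [pow_zero, one_mul]

/-- `Δ(a_{uv})` has the component `u ⊗ a_v`. -/
theorem comul_gen_right (hq : IsPrimitiveRoot q n) (hn : 2 ≤ n) (u v : TaftCategory k n) :
    comul hq rfl (mul_left_comm u t v) (gen (u * v)) = 𝟙 u ⊗ₜ[k] gen v := by
  rw [gen_eq, comul_E, delta_succ, delta_zero, delta_zero, map_tmul, map_tmul, L_E, L_E,
    E_zero_self, gen_eq, E_of_ne (u := v) (v := t * v) (l := 0), map_zero, tmul_zero, smul_zero,
    add_zero]
  · rfl
  · rw [pow_zero, one_mul]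
    exact (t_mul_ne hn v).symm

/-- `Δ(a_{uv})` has the component `q ^ j a_u ⊗ v` for `v = t ^ j`. -/
theorem comul_gen_left (hq : IsPrimitiveRoot q n) (hn : 2 ≤ n) (u v : TaftCategory k n) :
    comul hq rfl (mul_assoc t u v) (gen (u * v)) = chi q v • (gen u ⊗ₜ[k] 𝟙 v) := by
  rw [gen_eq, comul_E, delta_succ, delta_zero, delta_zero, map_tmul, map_tmul, L_E, L_E,
    E_zero_self, gen_eq, E_of_ne (u := u) (v := t * u) (l := 0), map_zero, zero_tmul, zero_add]
  · rfl
  · rw [pow_zero, one_mul]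
    exact (t_mul_ne hn u).symm

/-- All the other components of `Δ(a_{uv})` are zero. -/
theorem comul_gen_of_ne (hq : IsPrimitiveRoot q n) {u v c d : TaftCategory k n}
    (h : c * d = t * (u * v)) (h1 : c ≠ u) (h2 : c ≠ t * u) :
    comul hq rfl h (gen (u * v)) = 0 := by
  rw [gen_eq, comul_E, delta_succ, delta_zero, delta_zero, map_tmul, map_tmul,
    E_of_ne (u := u) (v := c) (l := 0), E_of_ne (u := t * u) (v := c) (l := 0), map_zero, map_zero,
    zero_tmul, zero_tmul, smul_zero, add_zero]
  · rw [pow_zero, one_mul]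
    exact h2.symm
  · rw [pow_zero, one_mul]
    exact h1.symm

theorem comul_L (hq : IsPrimitiveRoot q n) {x y a b c d : TaftCategory k n} (hx : a * b = x)
    (hy : c * d = y) (h1 : a * (t * b) = t * x) (h2 : t * a * b = t * x) (f : t * x ⟶ y) :
    comul hq hx hy (L x y f) = TensorProduct.map LinearMap.id (L b d) (comul hq h1 hy f) +
      chi q b • TensorProduct.map (L a c) LinearMap.id (comul hq h2 hy f) := by
  induction f using hom_ind with
  | h0 => simp only [map_zero, smul_zero, add_zero]
  | hadd f f' h h' => simp only [map_add, h, h', smul_add]; abel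
  | hsmul r f h => simp only [map_smul, h, smul_add, smul_comm r]
  | hE l hl => rw [L_E, comul_E, comul_E, comul_E, delta_succ]

theorem assoc_one {X Y Z V W : Type*} [AddCommGroup X] [AddCommGroup Y] [AddCommGroup Z]
    [AddCommGroup V] [AddCommGroup W] [Module k X] [Module k Y] [Module k Z] [Module k V]
    [Module k W] (F : X →ₗ[k] V ⊗[k] W) (g : Y →ₗ[k] Z) (z : X ⊗[k] Y) :
    TensorProduct.assoc k V W Z
      (TensorProduct.map F LinearMap.id (TensorProduct.map LinearMap.id g z)) =
    TensorProduct.map LinearMap.id (TensorProduct.map LinearMap.id g)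
      (TensorProduct.assoc k V W Y (TensorProduct.map F LinearMap.id z)) := by
  rw [TensorProduct.map_map_assoc, TensorProduct.map_id]
  simp only [← LinearMap.comp_apply, ← TensorProduct.map_comp, LinearMap.comp_id,
    LinearMap.id_comp]

theorem assoc_two {V V' W Z : Type*} [AddCommGroup Z] [AddCommGroup V] [AddCommGroup V']
    [AddCommGroup W] [Module k Z] [Module k V] [Module k V'] [Module k W] (g : V →ₗ[k] V')
    (z : (V ⊗[k] W) ⊗[k] Z) :
    TensorProduct.assoc k V' W Z
      (TensorProduct.map (TensorProduct.map g LinearMap.id) LinearMap.id z) =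
    TensorProduct.map g LinearMap.id (TensorProduct.assoc k V W Z z) := by
  rw [← TensorProduct.map_map_assoc, TensorProduct.map_id]

theorem assoc_three {V W W' Z : Type*} [AddCommGroup Z] [AddCommGroup V] [AddCommGroup W']
    [AddCommGroup W] [Module k Z] [Module k V] [Module k W'] [Module k W] (g : W →ₗ[k] W')
    (z : (V ⊗[k] W) ⊗[k] Z) :
    TensorProduct.assoc k V W' Z
      (TensorProduct.map (TensorProduct.map LinearMap.id g) LinearMap.id z) =
    TensorProduct.map LinearMap.id (TensorProduct.map g LinearMap.id)
      (TensorProduct.assoc k V W Z z) := by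
  rw [← TensorProduct.map_map_assoc]

theorem coassoc_delta (hq : IsPrimitiveRoot q n) (l : ℕ)
    {a₁ a₂ a₃ a₁₂ a₂₃ c₁ c₂ c₃ c₁₂ c₂₃ : TaftCategory k n}
    (ha₁₂ : a₁ * a₂ = a₁₂) (ha₂₃ : a₂ * a₃ = a₂₃) (hc₁₂ : c₁ * c₂ = c₁₂) (hc₂₃ : c₂ * c₃ = c₂₃) :
    TensorProduct.assoc k (a₁ ⟶ c₁) (a₂ ⟶ c₂) (a₃ ⟶ c₃)
        (TensorProduct.map (comul hq ha₁₂ hc₁₂) LinearMap.id (delta q l a₁₂ a₃ c₁₂ c₃)) =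
      TensorProduct.map LinearMap.id (comul hq ha₂₃ hc₂₃) (delta q l a₁ a₂₃ c₁ c₂₃) := by
  induction l generalizing a₁ a₂ a₃ a₁₂ a₂₃ with
  | zero =>
    rw [delta_zero, delta_zero, map_tmul, map_tmul, comul_E, comul_E, delta_zero, delta_zero]
    rfl
  | succ l ih =>
    have e1 : a₁ * (t * a₂) = t * a₁₂ := by rw [mul_left_comm, ha₁₂]
    have e2 : t * a₁ * a₂ = t * a₁₂ := by rw [mul_assoc, ha₁₂]
    have e3 : a₂ * (t * a₃) = t * a₂₃ := by rw [mul_left_comm, ha₂₃]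
    have e4 : t * a₂ * a₃ = t * a₂₃ := by rw [mul_assoc, ha₂₃]
    have hL : comul hq ha₁₂ hc₁₂ ∘ₗ L a₁₂ c₁₂ =
        TensorProduct.map LinearMap.id (L a₂ c₂) ∘ₗ comul hq e1 hc₁₂ +
        chi q a₂ • (TensorProduct.map (L a₁ c₁) LinearMap.id ∘ₗ comul hq e2 hc₁₂) :=
      LinearMap.ext (comul_L hq ha₁₂ hc₁₂ e1 e2)
    have hL' : comul hq ha₂₃ hc₂₃ ∘ₗ L a₂₃ c₂₃ =
        TensorProduct.map LinearMap.id (L a₃ c₃) ∘ₗ comul hq e3 hc₂₃ +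
        chi q a₃ • (TensorProduct.map (L a₂ c₂) LinearMap.id ∘ₗ comul hq e4 hc₂₃) :=
      LinearMap.ext (comul_L hq ha₂₃ hc₂₃ e3 e4)
    have i1 := ih ha₁₂ e3
    have i2 := ih e1 e4
    have i3 := ih (a₁ := t * a₁) (a₁₂ := t * a₁₂) e2 ha₂₃
    have hchi : chi q a₂₃ = chi q a₂ * chi q a₃ := by rw [← ha₂₃, chi_mul hq.pow_eq_one]
    have s2 : ∀ z : (t * a₁₂ ⟶ c₁₂) ⊗[k] (a₃ ⟶ c₃),
        TensorProduct.map (comul hq ha₁₂ hc₁₂) LinearMap.id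
          (TensorProduct.map (L a₁₂ c₁₂) LinearMap.id z) =
        TensorProduct.map (TensorProduct.map LinearMap.id (L a₂ c₂)) LinearMap.id
          (TensorProduct.map (comul hq e1 hc₁₂) LinearMap.id z) +
        chi q a₂ • TensorProduct.map (TensorProduct.map (L a₁ c₁) LinearMap.id) LinearMap.id
          (TensorProduct.map (comul hq e2 hc₁₂) LinearMap.id z) := by
      intro z
      simp only [← LinearMap.comp_apply, ← TensorProduct.map_comp, hL, LinearMap.comp_id,
        TensorProduct.map_add_left, TensorProduct.map_smul_left, LinearMap.add_apply,
        LinearMap.smul_apply]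
    rw [delta_succ, delta_succ, map_add, map_add, map_smul, map_smul, map_add, map_smul, s2,
      map_add, map_smul, assoc_one, assoc_two, assoc_three, i1, i2, i3, hchi]
    simp only [← LinearMap.comp_apply, ← TensorProduct.map_comp, LinearMap.comp_id,
      LinearMap.id_comp, hL', TensorProduct.map_add_right, TensorProduct.map_smul_right,
      LinearMap.add_apply, LinearMap.smul_apply, smul_add, smul_smul]
    rw [mul_comm (chi q a₂), add_assoc]

theorem coassoc (hq : IsPrimitiveRoot q n)
    {x y a₁ a₂ a₃ a₁₂ a₂₃ c₁ c₂ c₃ c₁₂ c₂₃ : TaftCategory k n}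
    (ha₁₂ : a₁ * a₂ = a₁₂) (ha : a₁₂ * a₃ = x) (ha₂₃ : a₂ * a₃ = a₂₃) (ha' : a₁ * a₂₃ = x)
    (hc₁₂ : c₁ * c₂ = c₁₂) (hc : c₁₂ * c₃ = y) (hc₂₃ : c₂ * c₃ = c₂₃) (hc' : c₁ * c₂₃ = y)
    (f : x ⟶ y) :
    TensorProduct.assoc k (a₁ ⟶ c₁) (a₂ ⟶ c₂) (a₃ ⟶ c₃)
        (TensorProduct.map (comul hq ha₁₂ hc₁₂) LinearMap.id (comul hq ha hc f)) =
      TensorProduct.map LinearMap.id (comul hq ha₂₃ hc₂₃) (comul hq ha' hc' f) := by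
  induction f using hom_ind with
  | h0 => simp only [map_zero]
  | hadd f f' h h' => simp only [map_add, h, h']
  | hsmul r f h => simp only [map_smul, h]
  | hE l hl => rw [comul_E, comul_E, coassoc_delta hq l ha₁₂ ha₂₃ hc₁₂ hc₂₃]

end

section
variable {k : Type*} [Field k] {n : ℕ} [NeZero n] {q : k}

/-- The counit of the Taft category: it is `1` on the identity of the object `1`, and zero on all
the other paths. -/
noncomputable def counit {x y : TaftCategory k n} : (x ⟶ y) →ₗ[k] k :=
  lift x y (fun l => if x = 1 ∧ y = 1 ∧ l = 0 then 1 else 0) fun l hl =>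
    if_neg fun h : x = 1 ∧ y = 1 ∧ l = 0 => NeZero.ne n (Nat.le_zero.1 (h.2.2 ▸ hl))

theorem counit_E (x y : TaftCategory k n) (l : ℕ) :
    counit (E x y l) = if x = 1 ∧ y = 1 ∧ l = 0 then (1 : k) else 0 := by
  by_cases h : t ^ l * x = y
  · exact lift_E x y _ _ h
  · rw [E_of_ne h, map_zero, if_neg]
    rintro ⟨rfl, rfl, rfl⟩
    exact h (by rw [pow_zero, one_mul])

theorem counit_comp {x y z : TaftCategory k n} (f : x ⟶ y) (g : y ⟶ z) :
    counit (f ≫ g) = counit g * counit f := by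
  induction f using hom_ind with
  | h0 => simp only [Limits.zero_comp, map_zero, mul_zero]
  | hadd f f' h h' => simp only [Preadditive.add_comp, map_add, mul_add, h, h']
  | hsmul r f h => simp only [Linear.smul_comp, map_smul, smul_eq_mul, h, mul_left_comm]
  | hE l hl =>
  induction g using hom_ind with
  | h0 => simp only [Limits.comp_zero, map_zero, zero_mul]
  | hadd f f' h h' => simp only [Preadditive.comp_add, map_add, add_mul, h, h']
  | hsmul r f h => simp only [Linear.comp_smul, map_smul, smul_eq_mul, h, mul_assoc]
  | hE m hm =>
  rw [E_comp, if_pos hl, counit_E, counit_E, counit_E]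
  by_cases h : x = 1 ∧ z = 1 ∧ l + m = 0
  · obtain ⟨rfl, rfl, h⟩ := h
    obtain ⟨rfl, rfl⟩ := Nat.add_eq_zero_iff.1 h
    have : y = 1 := by rw [← hl, pow_zero, one_mul]
    subst this
    simp
  · rw [if_neg h]
    symm
    rw [mul_eq_zero]
    by_contra! h'
    have h1 := (ite_ne_right_iff.1 h'.1).1
    have h2 := (ite_ne_right_iff.1 h'.2).1
    exact h ⟨h2.1, h1.2.1, by omega⟩

theorem counit_L {x y : TaftCategory k n} (f : t * x ⟶ y) : counit (L x y f) = 0 := by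
  induction f using hom_ind with
  | h0 => simp only [map_zero]
  | hadd f f' h h' => simp only [map_add, h, h', add_zero]
  | hsmul r f h => simp only [map_smul, h, smul_zero]
  | hE l hl => rw [L_E, counit_E, if_neg (by simp)]

theorem counit_L' (x y : TaftCategory k n) : counit ∘ₗ L x y = (0 : _ →ₗ[k] k) :=
  LinearMap.ext counit_L

theorem counit_left_delta (l : ℕ) (x y : TaftCategory k n) :
    TensorProduct.lid k (x ⟶ y)
      (TensorProduct.map (counit (x := 1) (y := 1)) LinearMap.id (delta q l 1 x 1 y)) =
      E x y l := by
  induction l generalizing x with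
  | zero => simp [delta_zero, counit_E]
  | succ l ih =>
    have h : ∀ z : ((1 : TaftCategory k n) ⟶ 1) ⊗[k] (t * x ⟶ y), TensorProduct.lid k (x ⟶ y)
        (TensorProduct.map (counit (x := 1) (y := 1)) LinearMap.id
          (TensorProduct.map LinearMap.id (L x y) z)) =
        L x y (TensorProduct.lid k (t * x ⟶ y)
          (TensorProduct.map (counit (x := 1) (y := 1)) LinearMap.id z)) := by
      intro z
      induction z with
      | zero => simp only [map_zero]
      | add z z' h h' => simp only [map_add, h, h']
      | tmul p r => simp
    rw [delta_succ, map_add, map_add, h, ih, L_E, map_smul]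
    simp only [← LinearMap.comp_apply, ← TensorProduct.map_comp, counit_L',
      TensorProduct.map_zero_left, LinearMap.zero_apply, smul_zero, map_zero, add_zero]

theorem counit_right_delta (l : ℕ) (x y : TaftCategory k n) :
    TensorProduct.rid k (x ⟶ y)
      (TensorProduct.map LinearMap.id (counit (x := 1) (y := 1)) (delta q l x 1 y 1)) =
      E x y l := by
  induction l generalizing x with
  | zero => simp [delta_zero, counit_E]
  | succ l ih =>
    have h : ∀ z : (t * x ⟶ y) ⊗[k] ((1 : TaftCategory k n) ⟶ 1), TensorProduct.rid k (x ⟶ y)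
        (TensorProduct.map LinearMap.id (counit (x := 1) (y := 1))
          (TensorProduct.map (L x y) LinearMap.id z)) =
        L x y (TensorProduct.rid k (t * x ⟶ y)
          (TensorProduct.map LinearMap.id (counit (x := 1) (y := 1)) z)) := by
      intro z
      induction z with
      | zero => simp only [map_zero]
      | add z z' h h' => simp only [map_add, h, h']
      | tmul p r => simp
    rw [delta_succ, chi_one, one_smul, map_add, map_add, h, ih, L_E]
    simp only [← LinearMap.comp_apply, ← TensorProduct.map_comp, counit_L',
      TensorProduct.map_zero_right, LinearMap.zero_apply, map_zero, zero_add]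

/-- The coefficient of the antipode on the path of length `l` from `x`. -/
def antipodeCoeff (q : k) : ℕ → TaftCategory k n → k
  | 0, _ => 1
  | l + 1, x => -chi q (t * x) * antipodeCoeff q l (t * x)

theorem antipodeCoeff_zero (x : TaftCategory k n) : antipodeCoeff q 0 x = 1 := rfl

theorem antipodeCoeff_succ (l : ℕ) (x : TaftCategory k n) :
    antipodeCoeff q (l + 1) x = -chi q (t * x) * antipodeCoeff q l (t * x) := rfl

theorem antipodeCoeff_add (l m : ℕ) (x : TaftCategory k n) :
    antipodeCoeff q (l + m) x = antipodeCoeff q l x * antipodeCoeff q m (t ^ l * x) := by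
  induction l generalizing x with
  | zero => rw [antipodeCoeff_zero, one_mul, pow_zero, one_mul, Nat.zero_add]
  | succ l ih =>
    rw [add_right_comm, antipodeCoeff_succ, antipodeCoeff_succ, ih, pow_succ, mul_assoc, mul_assoc]

/-- The antipode of the Taft category; it maps the generating morphism `a_u : u → t u` to
`- q ^ (i + 1) a_{(t u)⁻¹}` where `u = t ^ i`. -/
noncomputable def antipode (q : k) {x y : TaftCategory k n} : (x ⟶ y) →ₗ[k] (y⁻¹ ⟶ x⁻¹) :=
  lift x y (fun l => antipodeCoeff q l x • E y⁻¹ x⁻¹ l) fun l hl => by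
    rw [E_of_le _ _ hl, smul_zero]

theorem antipode_E (x y : TaftCategory k n) (l : ℕ) :
    antipode q (E x y l) = antipodeCoeff q l x • E y⁻¹ x⁻¹ l := by
  by_cases h : t ^ l * x = y
  · exact lift_E x y _ _ h
  · rw [E_of_ne h, map_zero, E_of_ne, smul_zero]
    intro h'
    apply h
    rw [← mul_right_inj y⁻¹, inv_mul_cancel, mul_left_comm, ← mul_assoc, h', inv_mul_cancel]

theorem antipode_id (x : TaftCategory k n) : antipode q (𝟙 x) = 𝟙 x⁻¹ := by
  rw [← E_zero_self, antipode_E, antipodeCoeff_zero, one_smul, E_zero_self]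

theorem antipode_comp {x y z : TaftCategory k n} (f : x ⟶ y) (g : y ⟶ z) :
    antipode q (f ≫ g) = antipode q g ≫ antipode q f := by
  induction f using hom_ind with
  | h0 => simp only [Limits.zero_comp, map_zero, Limits.comp_zero]
  | hadd f f' h h' => simp only [Preadditive.add_comp, map_add, Preadditive.comp_add, h, h']
  | hsmul r f h => simp only [Linear.smul_comp, map_smul, Linear.comp_smul, h]
  | hE l hl =>
  induction g using hom_ind with
  | h0 => simp only [Limits.comp_zero, map_zero, Limits.zero_comp]
  | hadd f f' h h' => simp only [Preadditive.comp_add, map_add, Preadditive.add_comp, h, h']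
  | hsmul r f h => simp only [Linear.comp_smul, map_smul, Linear.smul_comp, h]
  | hE m hm =>
  have h : t ^ m * z⁻¹ = y⁻¹ := by rw [← hm, mul_inv, mul_inv_cancel_left]
  rw [E_comp, if_pos hl, antipode_E, antipode_E, antipode_E, antipodeCoeff_add, hl,
    Linear.smul_comp, Linear.comp_smul, E_comp, if_pos h, smul_smul, add_comm l m,
    mul_comm (antipodeCoeff q l x)]

theorem antipode_L {x y : TaftCategory k n} (f : t * x ⟶ y) :
    antipode q (L x y f) = -chi q (t * x) • (antipode q f ≫ E (t * x)⁻¹ x⁻¹ 1) := by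
  refine (antipode_comp (E x (t * x) 1) f).trans ?_
  rw [antipode_E, antipodeCoeff_succ, antipodeCoeff_zero, mul_one, Linear.comp_smul]

theorem antipode_R {x y : TaftCategory k n} (f : x ⟶ t⁻¹ * y) :
    antipode q (R x y f) = -chi q y • (E y⁻¹ (t⁻¹ * y)⁻¹ 1 ≫ antipode q f) := by
  refine (antipode_comp f (E (t⁻¹ * y) y 1)).trans ?_
  rw [antipode_E, antipodeCoeff_succ, antipodeCoeff_zero, mul_one, Linear.smul_comp,
    mul_inv_cancel_left]

/-- `f'' ⊗ f' ↦ S(f'') f'` -/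
noncomputable def mulS (q : k) (a b c : TaftCategory k n) :
    (a ⟶ c) ⊗[k] (b ⟶ c⁻¹) →ₗ[k] (b ⟶ a⁻¹) :=
  TensorProduct.lift ((Linear.comp b c⁻¹ a⁻¹).flip ∘ₗ antipode q)

theorem mulS_tmul (a b c : TaftCategory k n) (p : a ⟶ c) (r : b ⟶ c⁻¹) :
    mulS q a b c (p ⊗ₜ r) = r ≫ antipode q p := rfl

theorem mulS_L_right (a b c : TaftCategory k n) (z : (a ⟶ c) ⊗[k] (t * b ⟶ c⁻¹)) :
    mulS q a b c (TensorProduct.map LinearMap.id (L b c⁻¹) z) = L b a⁻¹ (mulS q a (t * b) c z) := by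
  induction z with
  | zero => simp only [map_zero]
  | add z z' h h' => simp only [map_add, h, h']
  | tmul p r => exact Category.assoc (E b (t * b) 1) r (antipode q p)

theorem mulS_L_left (a b c : TaftCategory k n) (z : (t * a ⟶ c) ⊗[k] (b ⟶ c⁻¹)) :
    mulS q a b c (TensorProduct.map (L a c) LinearMap.id z) =
      -chi q (t * a) • (mulS q (t * a) b c z ≫ E (t * a)⁻¹ a⁻¹ 1) := by
  induction z with
  | zero => simp only [map_zero, Limits.zero_comp, smul_zero]
  | add z z' h h' => simp only [map_add, h, h', Preadditive.add_comp, smul_add]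
  | tmul p r =>
    rw [map_tmul, mulS_tmul, antipode_L, Linear.comp_smul, mulS_tmul, Category.assoc]
    rfl

theorem sum_mulS_succ (l : ℕ) (a b : TaftCategory k n) :
    ∑ c, mulS q a b c (delta q (l + 1) a b c c⁻¹) =
      L b a⁻¹ (∑ c, mulS q a (t * b) c (delta q l a (t * b) c c⁻¹)) -
      (chi q b * chi q (t * a)) •
        ((∑ c, mulS q (t * a) b c (delta q l (t * a) b c c⁻¹)) ≫ E (t * a)⁻¹ a⁻¹ 1) := by
  simp only [delta_succ, map_add, map_smul, mulS_L_right, mulS_L_left, Finset.sum_add_distrib,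
    map_sum, Preadditive.sum_comp, Finset.smul_sum, mul_smul, neg_smul,
    smul_neg, Finset.sum_neg_distrib, sub_eq_add_neg]

theorem sum_mulS_zero (a b : TaftCategory k n) :
    ∑ c, mulS q a b c (delta q 0 a b c c⁻¹) = E b a⁻¹ 0 := by
  rw [Finset.sum_eq_single a]
  · rw [delta_zero, mulS_tmul, E_zero_self, antipode_id, Category.comp_id]
  · intro c _ hc
    rw [delta_zero, E_of_ne (v := c) (by rw [pow_zero, one_mul]; exact hc.symm), zero_tmul,
      map_zero]
  · intro h; exact absurd (Finset.mem_univ _) h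

theorem sum_mulS (hq : q ^ n = 1) (l : ℕ) (a b : TaftCategory k n) :
    ∑ c, mulS q a b c (delta q (l + 1) a b c c⁻¹) = 0 := by
  induction l generalizing a b with
  | zero =>
    rw [sum_mulS_succ, sum_mulS_zero, sum_mulS_zero, L_E, E_comp]
    split_ifs with h
    · rw [← chi_mul hq]
      rw [pow_zero, one_mul] at h
      rw [h, inv_mul_cancel, chi_one, one_smul, sub_self]
    · rw [smul_zero, sub_zero]
      refine E_of_ne fun h' => h ?_
      rw [pow_zero, one_mul, mul_inv, ← h', zero_add, pow_one, inv_mul_cancel_left]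
  | succ l ih => rw [sum_mulS_succ, ih, ih, map_zero, Limits.zero_comp, smul_zero, sub_zero]

/-- `f'' ⊗ f' ↦ f'' S(f')` -/
noncomputable def mulS' (q : k) (b c d : TaftCategory k n) :
    (b⁻¹ ⟶ c) ⊗[k] (b ⟶ d) →ₗ[k] (d⁻¹ ⟶ c) :=
  TensorProduct.lift ((Linear.comp d⁻¹ b⁻¹ c).flip.compl₂ (antipode q))

theorem mulS'_tmul (b c d : TaftCategory k n) (p : b⁻¹ ⟶ c) (r : b ⟶ d) :
    mulS' q b c d (p ⊗ₜ r) = antipode q r ≫ p := rfl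

theorem mulS'_R_right (b c d : TaftCategory k n) (z : (b⁻¹ ⟶ c) ⊗[k] (b ⟶ t⁻¹ * d)) :
    mulS' q b c d (TensorProduct.map LinearMap.id (R b d) z) =
      -chi q d • (E d⁻¹ (t⁻¹ * d)⁻¹ 1 ≫ mulS' q b c (t⁻¹ * d) z) := by
  induction z with
  | zero => simp only [map_zero, Limits.comp_zero, smul_zero]
  | add z z' h h' => simp only [map_add, h, h', Preadditive.comp_add, smul_add]
  | tmul p r =>
    rw [map_tmul, mulS'_tmul, antipode_R, Linear.smul_comp, mulS'_tmul, Category.assoc]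
    rfl

theorem mulS'_R_left (b c d : TaftCategory k n) (z : (b⁻¹ ⟶ t⁻¹ * c) ⊗[k] (b ⟶ d)) :
    mulS' q b c d (TensorProduct.map (R b⁻¹ c) LinearMap.id z) =
      R d⁻¹ c (mulS' q b (t⁻¹ * c) d z) := by
  induction z with
  | zero => simp only [map_zero]
  | add z z' h h' => simp only [map_add, h, h']
  | tmul p r => exact (Category.assoc (antipode q r) p (E (t⁻¹ * c) c 1)).symm

theorem sum_mulS'_succ (l : ℕ) (c d : TaftCategory k n) :
    ∑ b, mulS' q b c d (delta q (l + 1) b⁻¹ b c d) =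
      chi q d • R d⁻¹ c (∑ b, mulS' q b (t⁻¹ * c) d (delta q l b⁻¹ b (t⁻¹ * c) d)) -
      chi q d • (E d⁻¹ (t⁻¹ * d)⁻¹ 1 ≫
        ∑ b, mulS' q b c (t⁻¹ * d) (delta q l b⁻¹ b c (t⁻¹ * d))) := by
  simp only [delta_succ', map_add, map_smul, mulS'_R_right, mulS'_R_left, Finset.sum_add_distrib,
    map_sum, Preadditive.comp_sum, Finset.smul_sum, neg_smul,
    Finset.sum_neg_distrib, sub_eq_add_neg]
  rw [add_comm]

theorem sum_mulS'_zero (c d : TaftCategory k n) :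
    ∑ b, mulS' q b c d (delta q 0 b⁻¹ b c d) = E d⁻¹ c 0 := by
  rw [Finset.sum_eq_single d]
  · rw [delta_zero, mulS'_tmul, E_zero_self, antipode_id, Category.id_comp]
  · intro b _ hb
    rw [delta_zero, E_of_ne (u := b) (v := d) (by rw [pow_zero, one_mul]; exact hb), tmul_zero,
      map_zero]
  · intro h; exact absurd (Finset.mem_univ _) h

theorem sum_mulS' (l : ℕ) (c d : TaftCategory k n) :
    ∑ b, mulS' q b c d (delta q (l + 1) b⁻¹ b c d) = 0 := by
  induction l generalizing c d with
  | zero =>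
    rw [sum_mulS'_succ, sum_mulS'_zero, sum_mulS'_zero, R_E, E_comp, if_pos, sub_self]
    rw [pow_one, mul_inv, inv_inv]
  | succ l ih => rw [sum_mulS'_succ, ih, ih, map_zero, Limits.comp_zero, smul_zero, sub_zero]

/-- The `n`-th Taft category as a Hopf `k`-category over `C_n`. -/
noncomputable def hopf (hq : IsPrimitiveRoot q n) : HopfStructure k (TaftCategory k n) where
  comul := comul hq
  comul_comp := comul_comp hq
  comul_id := comul_id hq
  comul_id_of_ne := comul_id_of_ne hq
  coassoc := coassoc hq
  counit := counit
  counit_comp := counit_comp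
  counit_id_one := by rw [← E_zero_self, counit_E, if_pos ⟨rfl, rfl, rfl⟩]
  counit_eq_zero {x y} f h := by
    induction f using hom_ind with
    | h0 => simp only [map_zero]
    | hadd f f' h h' => simp only [map_add, h, h', add_zero]
    | hsmul r f h => simp only [map_smul, h, smul_zero]
    | hE l hl =>
      rw [counit_E, if_neg]
      rintro ⟨rfl, rfl, -⟩
      simp at h
  counit_left {x y} f := by
    induction f using hom_ind with
    | h0 => simp only [map_zero]
    | hadd f f' h h' => simp only [map_add, h, h']
    | hsmul r f h => simp only [map_smul, h]
    | hE l hl => rw [comul_E, counit_left_delta]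
  counit_right {x y} f := by
    induction f using hom_ind with
    | h0 => simp only [map_zero]
    | hadd f f' h h' => simp only [map_add, h, h']
    | hsmul r f h => simp only [map_smul, h]
    | hE l hl => rw [comul_E, counit_right_delta]
  antipode := antipode q
  antipode_id := antipode_id
  antipode_comp := antipode_comp
  antipode_left a f := by
    change ∑ c, mulS q a a⁻¹ c (comul hq _ _ f) = _
    induction f using hom_ind with
    | h0 => simp only [map_zero, Finset.sum_const_zero, zero_smul]
    | hadd f f' h h' => simp only [map_add, Finset.sum_add_distrib, h, h', add_smul]
    | hsmul r f h => simp only [map_smul, ← Finset.smul_sum, h, smul_assoc]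
    | hE l hl =>
      simp only [comul_E]
      cases l with
      | zero =>
        rw [sum_mulS_zero, counit_E, if_pos ⟨rfl, rfl, rfl⟩, one_smul, E_zero_self]
      | succ l => rw [sum_mulS hq.pow_eq_one, counit_E, if_neg (by simp), zero_smul]
  antipode_left_of_ne {x a b} h f hx := by
    change ∑ c, mulS q a b c (comul hq _ _ f) = _
    induction f using hom_ind with
    | h0 => simp only [map_zero, Finset.sum_const_zero]
    | hadd f f' h h' => simp only [map_add, Finset.sum_add_distrib, h, h', add_zero]
    | hsmul r f h => simp only [map_smul, ← Finset.smul_sum, h, smul_zero]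
    | hE l hl =>
      simp only [comul_E]
      cases l with
      | zero => exact absurd (by rw [← hl, pow_zero, one_mul]) hx
      | succ l => rw [sum_mulS hq.pow_eq_one]
  antipode_right d f := by
    change ∑ b, mulS' q b d⁻¹ d (comul hq _ _ f) = _
    induction f using hom_ind with
    | h0 => simp only [map_zero, Finset.sum_const_zero, zero_smul]
    | hadd f f' h h' => simp only [map_add, Finset.sum_add_distrib, h, h', add_smul]
    | hsmul r f h => simp only [map_smul, ← Finset.smul_sum, h, smul_assoc]
    | hE l hl =>
      simp only [comul_E]
      cases l with
      | zero =>
        rw [sum_mulS'_zero, counit_E, if_pos ⟨rfl, rfl, rfl⟩, one_smul, E_zero_self]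
      | succ l => rw [sum_mulS', counit_E, if_neg (by simp), zero_smul]
  antipode_right_of_ne {y c d} h f hy := by
    change ∑ b, mulS' q b c d (comul hq _ _ f) = _
    induction f using hom_ind with
    | h0 => simp only [map_zero, Finset.sum_const_zero]
    | hadd f f' h h' => simp only [map_add, Finset.sum_add_distrib, h, h', add_zero]
    | hsmul r f h => simp only [map_smul, ← Finset.smul_sum, h, smul_zero]
    | hE l hl =>
      simp only [comul_E]
      cases l with
      | zero => exact absurd (by rw [← hl, pow_zero, one_mul]) hy
      | succ l => rw [sum_mulS']

end
end TaftCategory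

/-- A grading of a `k`-category by a group `Γ`; `piece s x y` is the component of degree `s` of
the space of morphisms from `x` to `y`. -/
structure LinGrading (k : Type*) [Field k] (C : Type*) [Category C] [Preadditive C] [Linear k C]
    (Γ : Type*) [Group Γ] where
  piece : Γ → ∀ x y : C, Submodule k (x ⟶ y)
  isInternal : open Classical in ∀ x y : C, DirectSum.IsInternal fun s => piece s x y
  comp_mem : ∀ {x y z : C} {s t : Γ} {f : x ⟶ y} {g : y ⟶ z},
    f ∈ piece s x y → g ∈ piece t y z → f ≫ g ∈ piece (t * s) x z

/-- Walks in a `k`-category: sequences of virtual morphisms `(f, 1)` or `(f, -1)` with `f` nonzero.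
The walk `cons w f` is `w` followed by `(f, 1)`, and `consInv w f` is `w` followed by `(f, -1)`. -/
inductive Walk (C : Type*) [Category C] [Preadditive C] : C → C → Type _
  | nil (x : C) : Walk C x x
  | cons {x y z : C} (w : Walk C x y) (f : y ⟶ z) (hf : f ≠ 0) : Walk C x z
  | consInv {x y z : C} (w : Walk C x y) (f : z ⟶ y) (hf : f ≠ 0) : Walk C x z

namespace LinGrading

/-- The walk `w` is homogeneous (all its morphisms are homogeneous) and its degree is `s`. -/
def HasDegree {k : Type*} [Field k] {C : Type*} [Category C] [Preadditive C] [Linear k C]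
    {Γ : Type*} [Group Γ] (X : LinGrading k C Γ) : ∀ {x y : C}, Walk C x y → Γ → Prop
  | _, _, Walk.nil _, s => s = 1
  | _, _, Walk.cons (y := y) (z := z) w f _, s =>
      ∃ d r : Γ, f ∈ X.piece d y z ∧ X.HasDegree w r ∧ s = d * r
  | _, _, Walk.consInv (y := y) (z := z) w f _, s =>
      ∃ d r : Γ, f ∈ X.piece d z y ∧ X.HasDegree w r ∧ s = d⁻¹ * r

/-- The grading is connected: between any two objects, homogeneous walks take all degrees. -/
def IsConnected {k : Type*} [Field k] {C : Type*} [Category C] [Preadditive C] [Linear k C]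
    {Γ : Type*} [Group Γ] (X : LinGrading k C Γ) : Prop :=
  ∀ (x y : C) (s : Γ), ∃ w : Walk C x y, X.HasDegree w s

end LinGrading

/-- A Hopf grading of a Hopf `k`-category by an abelian group: a grading such that the identities
have trivial degree, and such that the comultiplication, the counit and the antipode are
homogeneous. -/
structure HopfGrading {k : Type*} [Field k] {G : Type*} [Group G] [Fintype G]
    [Category G] [Preadditive G] [Linear k G] (H : HopfStructure k G)
    (Γ : Type*) [CommGroup Γ] extends LinGrading k G Γ where
  id_mem : ∀ x : G, 𝟙 x ∈ piece 1 x x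
  comul_mem : ∀ {x y a b c d : G} (hx : a * b = x) (hy : c * d = y) {s : Γ} {f : x ⟶ y},
    f ∈ piece s x y → H.comul hx hy f ∈ ⨆ p : {p : Γ × Γ // p.1 * p.2 = s},
      LinearMap.range
        (TensorProduct.map (piece p.1.1 a c).subtype (piece p.1.2 b d).subtype)
  counit_eq_zero : ∀ {x y : G} {s : Γ} {f : x ⟶ y}, f ∈ piece s x y → s ≠ 1 → H.counit f = 0
  antipode_mem : ∀ {x y : G} {s : Γ} {f : x ⟶ y},
    f ∈ piece s x y → H.antipode f ∈ piece s y⁻¹ x⁻¹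

/-- An invertible endofunctor of a Hopf `k`-category, which is the identity on objects. -/
structure HopfAutomorphism {k : Type*} [Field k] {G : Type*} [Group G] [Fintype G]
    [Category G] [Preadditive G] [Linear k G] (H : HopfStructure k G) where
  map : ∀ {x y : G}, (x ⟶ y) ≃ₗ[k] (x ⟶ y)
  map_id : ∀ x : G, map (𝟙 x) = 𝟙 x
  map_comp : ∀ {x y z : G} (f : x ⟶ y) (g : y ⟶ z), map (f ≫ g) = map f ≫ map g
  map_comul : ∀ {x y a b c d : G} (hx : a * b = x) (hy : c * d = y) (f : x ⟶ y),
    H.comul hx hy (map f) =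
      TensorProduct.map map.toLinearMap map.toLinearMap (H.comul hx hy f)
  map_counit : ∀ {x y : G} (f : x ⟶ y), H.counit (map f) = H.counit f
  map_antipode : ∀ {x y : G} (f : x ⟶ y), H.antipode (map f) = map (H.antipode f)

/-- The image of a walk. -/
def HopfAutomorphism.mapWalk {k : Type*} [Field k] {G : Type*} [Group G] [Fintype G]
    [Category G] [Preadditive G] [Linear k G] {H : HopfStructure k G} (J : HopfAutomorphism H) :
    ∀ {x y : G}, Walk G x y → Walk G x y
  | _, _, Walk.nil _ => Walk.nil _
  | _, _, Walk.cons w f hf =>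
      Walk.cons (J.mapWalk w) (J.map f) fun h => hf ((LinearEquiv.map_eq_zero_iff J.map).1 h)
  | _, _, Walk.consInv w f hf =>
      Walk.consInv (J.mapWalk w) (J.map f) fun h => hf ((LinearEquiv.map_eq_zero_iff J.map).1 h)

/-- The connected Hopf gradings of a Hopf `k`-category, by abelian groups. -/
structure ConnectedHopfGrading {k : Type*} [Field k] {G : Type*} [Group G] [Fintype G]
    [Category G] [Preadditive G] [Linear k G] (H : HopfStructure k G) where
  Γ : Type w
  [commGroup : CommGroup Γ]
  grading : HopfGrading H Γ
  connected : grading.IsConnected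

attribute [instance] ConnectedHopfGrading.commGroup

namespace ConnectedHopfGrading

section
variable {k : Type*} [Field k] {G : Type*} [Group G] [Fintype G]
    [Category G] [Preadditive G] [Linear k G] {H : HopfStructure k G}

/-- Morphisms of connected Hopf gradings: the group homomorphisms `μ` for which there is a
homogeneous invertible endofunctor `J` of the Hopf `k`-category such that
`deg_Y (J w) = μ (deg_X w)` for all `X`-homogeneous closed walks `w` at the object `1`. -/
def IsMorphism (X Y : ConnectedHopfGrading.{w} H) (μ : X.Γ →* Y.Γ) : Prop :=
  ∃ J : HopfAutomorphism H,
    (∀ (x y : G) (s : X.Γ) (f : x ⟶ y), f ∈ X.grading.piece s x y →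
      ∃ s' : Y.Γ, J.map f ∈ Y.grading.piece s' x y) ∧
    ∀ (w : Walk G 1 1) (s : X.Γ), X.grading.HasDegree w s →
      Y.grading.HasDegree (J.mapWalk w) (μ s)

/-- A connected Hopf grading is universal if it has a unique morphism to each connected Hopf
grading. -/
def IsUniversal (V : ConnectedHopfGrading.{w} H) : Prop :=
  ∀ Y : ConnectedHopfGrading.{w} H, ∃! μ : V.Γ →* Y.Γ, V.IsMorphism Y μ

end

end ConnectedHopfGrading

/-- The fundamental group of a Hopf `k`-category: the families of elements `γ X ∈ Γ_X`, where `X`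
varies amongst the connected Hopf gradings with finite abelian grading group, which are compatible
with all morphisms of connected Hopf gradings. -/
def hopfFundamentalGroup {k : Type*} [Field k] {G : Type*} [Group G] [Fintype G]
    [Category G] [Preadditive G] [Linear k G] (H : HopfStructure k G) :
    Subgroup (∀ X : {X : ConnectedHopfGrading.{w} H // Finite X.Γ}, X.1.Γ) where
  carrier := {γ | ∀ (X Y : {X : ConnectedHopfGrading.{w} H // Finite X.Γ}) (μ : X.1.Γ →* Y.1.Γ),
    X.1.IsMorphism Y.1 μ → μ (γ X) = γ Y}
  one_mem' _ _ μ _ := map_one μ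
  mul_mem' h h' X Y μ hμ := (map_mul μ _ _).trans (congrArg₂ _ (h X Y μ hμ) (h' X Y μ hμ))
  inv_mem' h X Y μ hμ := (map_inv μ _).trans (congrArg _ (h X Y μ hμ))

/-- The inverse limit of the groups `ℤ/mℤ` for `m` coprime to `n`, with respect to the canonical
projections `ℤ/mℤ → ℤ/m'ℤ` for `m'` dividing `m`. -/
def coprimeLimit (n : ℕ) : AddSubgroup (∀ m : {m : ℕ // m.Coprime n}, ZMod m) where
  carrier := {x | ∀ (m m' : {m : ℕ // m.Coprime n}) (h : m'.1 ∣ m.1),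
    ZMod.castHom h (ZMod m') (x m) = x m'}
  zero_mem' _ _ _ := map_zero _
  add_mem' hx hy m m' h := (map_add _ _ _).trans (congrArg₂ _ (hx m m' h) (hy m m' h))
  neg_mem' hx m m' h := (map_neg _ _).trans (congrArg _ (hx m m' h))

/-! The crown has exactly one path of each length from each object, and paths of length at least `n`
vanish. Hence every morphism space is a line, spanned by the path of length `dist x y < n`
(`exists_smul_base`), and in any grading every morphism is homogeneous. A grading is therefore only
an assignment of degrees to these lines.

Homogeneity of the comultiplication pins the assignment down: `Δ(a_{uv})` has the nonzero component
`u ⊗ a_v` and identities have degree `1`, so `a_v` and `a_{uv}` have the same degree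
(`exists_hasGenDegree`). With `g` this common degree, a walk has degree `g` to the power of its
signed length (`hasDegree_iff`). Closed walks have exactly the multiples of `n` as lengths, so the
grading is connected if and only if `g ^ n` generates `Γ` (`isConnected_iff`). Then `g` itself is a
power of `g ^ n`, say `g ^ (n * j - 1) = 1`; the exponent is nonzero and prime to `n`, so `Γ` is
finite cyclic of order prime to `n` (`finite_of_zpowers_pow`). Conversely every `g` defines a Hopf
grading (`stdGrading`), and every order prime to `n` is attained by a connected one
(`exists_card_eq`).

An automorphism which fixes the objects preserves the lengths of walks, so a morphism of gradings is
a homomorphism taking the loop degree `g ^ n` to the loop degree (`isMorphism_iff`). As loop degrees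
generate, there is at most one morphism from `X` to `Y`, and one exists exactly when the order of
`Γ_Y` divides that of `Γ_X`. The connected gradings thus form, up to isomorphism, the set of
integers prime to `n` under divisibility. It has no element divisible by all the others, so there is
no universal grading; and a compatible family, written as powers of the loop degrees, is a
compatible family of exponents modulo all `m` prime to `n`. -/

namespace TaftCategory

/-! ### The morphism spaces are lines -/

section
variable {k : Type*} [Field k] {n : ℕ} [NeZero n]

theorem t_pow_eq_ofAdd (l : ℕ) :
    (t ^ l : TaftCategory k n) = (show Multiplicative (ZMod n) from
      Multiplicative.ofAdd (l : ZMod n)) := by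
  have : (Multiplicative.ofAdd (1 : ZMod n)) ^ l = Multiplicative.ofAdd (l : ZMod n) := by
    rw [← ofAdd_nsmul, nsmul_one]
  exact this

theorem t_pow_eq_iff (l m : ℕ) :
    (t ^ l : TaftCategory k n) = t ^ m ↔ l ≡ m [MOD n] := by
  rw [t_pow_eq_ofAdd, t_pow_eq_ofAdd]
  exact (Multiplicative.ofAdd.injective.eq_iff (a := (l : ZMod n)) (b := (m : ZMod n))).trans
    (ZMod.natCast_eq_natCast_iff l m n)

theorem t_zpow_eq_one_iff (j : ℤ) : (t ^ j : TaftCategory k n) = 1 ↔ (n : ℤ) ∣ j := by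
  have h : orderOf (t : TaftCategory k n) = n := by
    refine Nat.dvd_antisymm (orderOf_dvd_of_pow_eq_one ?_) ?_
    · rw [← pow_zero t, t_pow_eq_iff]
      exact (Nat.modEq_zero_iff_dvd).2 dvd_rfl
    · have := pow_orderOf_eq_one (t : TaftCategory k n)
      rw [← pow_zero t, t_pow_eq_iff] at this
      exact (Nat.modEq_zero_iff_dvd).1 this
  rw [← orderOf_dvd_iff_zpow_eq_one, h]

/-- The length of the shortest path from `x` to `y` in the crown. -/
def dist (x y : TaftCategory k n) : ℕ :=
  (Multiplicative.toAdd (show Multiplicative (ZMod n) from y * x⁻¹)).val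

theorem dist_lt (x y : TaftCategory k n) : dist x y < n := ZMod.val_lt _

theorem t_pow_dist (x y : TaftCategory k n) : t ^ dist x y * x = y := by
  rw [t_pow_eq_ofAdd, dist, ZMod.natCast_zmod_val]
  exact inv_mul_cancel_right y x

theorem eq_dist {x y : TaftCategory k n} {l : ℕ} (hl : l < n) (h : t ^ l * x = y) :
    l = dist x y := by
  have := h.trans (t_pow_dist x y).symm
  rw [mul_left_inj, t_pow_eq_iff] at this
  exact Nat.ModEq.eq_of_lt_of_lt this hl (dist_lt x y)

/-- The coefficient of a morphism with respect to the shortest path. -/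
noncomputable def coeff (x y : TaftCategory k n) : (x ⟶ y) →ₗ[k] k :=
  lift x y (fun l => if l < n then 1 else 0) fun _ hl => if_neg hl.not_gt

theorem coeff_E {x y : TaftCategory k n} {l : ℕ} (hl : l < n) (h : t ^ l * x = y) :
    coeff x y (E x y l) = 1 := (lift_E x y _ _ h).trans (if_pos hl)

/-- The shortest path from `x` to `y`, as a morphism. -/
noncomputable def base (x y : TaftCategory k n) : x ⟶ y := E x y (dist x y)

theorem coeff_base (x y : TaftCategory k n) : coeff x y (base x y) = 1 :=
  coeff_E (dist_lt x y) (t_pow_dist x y)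

theorem base_ne_zero (x y : TaftCategory k n) : base x y ≠ 0 := by
  intro h
  have := coeff_base x y
  rw [h, map_zero] at this
  exact zero_ne_one this

/-- The lengths of the paths from `x` to `y` form one residue class modulo `n`, and only its
representative below `n` gives a nonzero morphism. -/
theorem exists_smul_base {x y : TaftCategory k n} (f : x ⟶ y) : ∃ c : k, f = c • base x y := by
  induction f using hom_ind with
  | h0 => exact ⟨0, (zero_smul _ _).symm⟩
  | hadd f f' h h' =>
    obtain ⟨c, rfl⟩ := h
    obtain ⟨c', rfl⟩ := h'
    exact ⟨c + c', (add_smul _ _ _).symm⟩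
  | hsmul r f h =>
    obtain ⟨c, rfl⟩ := h
    exact ⟨r * c, smul_smul _ _ _⟩
  | hE l hl =>
    rcases le_or_gt n l with h | h
    · exact ⟨0, by rw [E_of_le _ _ h, zero_smul]⟩
    · exact ⟨1, by rw [one_smul, base, eq_dist h hl]⟩

/-- A subspace of a line is zero or everything. Together with `mem_of_base_mem`, this reduces
membership of any nonzero morphism in a homogeneous component to that of the basis vector. -/
theorem base_mem_of_mem {x y : TaftCategory k n} {S : Submodule k (x ⟶ y)} {f : x ⟶ y}
    (hf : f ≠ 0) (h : f ∈ S) : base x y ∈ S := by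
  obtain ⟨c, rfl⟩ := exists_smul_base f
  have hc : c ≠ 0 := by
    rintro rfl
    exact hf (zero_smul _ _)
  exact (Submodule.smul_mem_iff S hc).1 h

theorem mem_of_base_mem {x y : TaftCategory k n} {S : Submodule k (x ⟶ y)} (f : x ⟶ y)
    (h : base x y ∈ S) : f ∈ S := by
  obtain ⟨c, rfl⟩ := exists_smul_base f
  exact S.smul_mem c h

theorem dist_self (x : TaftCategory k n) : dist x x = 0 :=
  (eq_dist (NeZero.pos n) (by rw [pow_zero, one_mul])).symm

theorem dist_t_mul (hn : 2 ≤ n) (x : TaftCategory k n) : dist x (t * x) = 1 :=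
  (eq_dist hn (by rw [pow_one])).symm

theorem base_t_mul (hn : 2 ≤ n) (x : TaftCategory k n) : base x (t * x) = gen x := by
  rw [base, dist_t_mul hn, gen_eq]

end

/-! ### Degrees of the generating morphisms -/

section
variable {k : Type*} [Field k] {n : ℕ} [NeZero n] {Γ : Type*}

/-- All the generating morphisms are homogeneous of degree `g`. -/
def HasGenDegree [Group Γ] (X : LinGrading k (TaftCategory k n) Γ) (g : Γ) : Prop :=
  ∀ u : TaftCategory k n, gen u ∈ X.piece g u (t * u)

/-- If no component contained the basis vector, all would be zero, and they could not span a nonzero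
line. -/
theorem exists_base_mem [Group Γ] (X : LinGrading k (TaftCategory k n) Γ)
    (x y : TaftCategory k n) : ∃ s, base x y ∈ X.piece s x y := by
  classical
  by_contra! h
  have h0 : ∀ s, X.piece s x y = ⊥ := fun s =>
    (Submodule.eq_bot_iff _).2 fun f hf => by_contra fun hf0 => h s (base_mem_of_mem hf0 hf)
  have h1 := (X.isInternal x y).submodule_iSup_eq_top
  simp only [h0, iSup_bot] at h1
  have : base x y ∈ (⊥ : Submodule k (x ⟶ y)) := by rw [h1]; trivial
  exact base_ne_zero x y ((Submodule.mem_bot k).1 this)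

theorem degree_unique [Group Γ] (X : LinGrading k (TaftCategory k n) Γ)
    {x y : TaftCategory k n} {f : x ⟶ y} (hf : f ≠ 0) {s s' : Γ} (h : f ∈ X.piece s x y)
    (h' : f ∈ X.piece s' x y) : s = s' := by
  classical
  by_contra hs
  have := (X.isInternal x y).submodule_iSupIndep.pairwiseDisjoint hs
  exact hf ((Submodule.disjoint_def.1 this) f h h')

theorem gen_ne_zero (hn : 2 ≤ n) (u : TaftCategory k n) : gen u ≠ 0 := by
  rw [← base_t_mul hn]
  exact base_ne_zero _ _

theorem HasGenDegree.unique [Group Γ] {X : LinGrading k (TaftCategory k n) Γ} (hn : 2 ≤ n)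
    {g g' : Γ} (h : HasGenDegree X g) (h' : HasGenDegree X g') : g = g' :=
  degree_unique X (gen_ne_zero hn 1) (h 1) (h' 1)

/-- Only the component `u ⊗ a_v` of `Δ(a_{uv})` is needed: its degree is that of `a_v`, since
identities have trivial degree, and it must be that of `a_{uv}`. -/
theorem exists_hasGenDegree [CommGroup Γ] {q : k} (hq : IsPrimitiveRoot q n) (hn : 2 ≤ n)
    (X : HopfGrading (hopf hq) Γ) : ∃ g, HasGenDegree X.toLinGrading g := by
  classical
  have hmem := fun u => exists_base_mem X.toLinGrading u (t * u)
  choose g hg using hmem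
  simp only [base_t_mul hn] at hg
  have key : ∀ u v, g v = g (u * v) := by
    intro u v
    have h := X.comul_mem (rfl : u * v = u * v) (mul_left_comm u t v) (hg (u * v))
    change comul hq (rfl : u * v = u * v) (mul_left_comm u t v) _ ∈ _ at h
    rw [comul_gen_right hq hn] at h
    by_contra hne
    -- Since both morphism spaces are lines, the only bidegree in which their tensor product lives
    -- is `(1, g v)`. If `g v ≠ g (u * v)`, this bidegree is not among those allowed, so every
    -- allowed summand is zero.
    have hbot : ∀ p : {p : Γ × Γ // p.1 * p.2 = g (u * v)}, LinearMap.range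
        (TensorProduct.map (X.piece p.1.1 u u).subtype (X.piece p.1.2 v (t * v)).subtype) = ⊥ := by
      rintro ⟨⟨p, r⟩, hp⟩
      rw [LinearMap.range_eq_bot]
      ext ⟨a, ha⟩ ⟨b, hb⟩
      change a ⊗ₜ[k] b = 0
      by_cases ha0 : a = 0
      · rw [ha0, zero_tmul]
      by_cases hb0 : b = 0
      · rw [hb0, tmul_zero]
      refine absurd ?_ hne
      have h1 : p = 1 := degree_unique X.toLinGrading (base_ne_zero u u) (base_mem_of_mem ha0 ha)
        (mem_of_base_mem _ (base_mem_of_mem (by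
          rw [← E_zero_self]
          have := base_ne_zero u u
          rwa [base, dist_self] at this) (X.id_mem u)))
      have h2 : r = g v := degree_unique X.toLinGrading (base_ne_zero v (t * v))
        (base_mem_of_mem hb0 hb) (by rw [base_t_mul hn]; exact hg v)
      rw [← hp, h1, h2, one_mul]
    simp only [hbot, iSup_bot, Submodule.mem_bot] at h
    -- The tensor product of the two coefficient functionals takes the value `1` on `u ⊗ a_v`, so
    -- that this element cannot be zero.
    have h3 := congrArg ((TensorProduct.lid k k).toLinearMap ∘ₗ
      TensorProduct.map (coeff u u) (coeff v (t * v))) h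
    rw [map_zero] at h3
    change coeff u u (𝟙 u) • coeff v (t * v) (gen v) = 0 at h3
    rw [← E_zero_self, gen_eq, coeff_E (NeZero.pos n) (by rw [pow_zero, one_mul]),
      coeff_E hn (by rw [pow_one]), one_smul] at h3
    exact one_ne_zero h3
  refine ⟨g 1, fun u => ?_⟩
  have := key u 1
  rw [mul_one] at this
  rw [this]
  exact hg u

theorem E_mem [CommGroup Γ] {q : k} {hq : IsPrimitiveRoot q n} {X : HopfGrading (hopf hq) Γ} {g : Γ}
    (hg : HasGenDegree X.toLinGrading g) (x y : TaftCategory k n) (l : ℕ) :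
    E x y l ∈ X.piece (g ^ l) x y := by
  by_cases h : t ^ l * x = y
  · subst h
    induction l with
    | zero =>
      rw [pow_zero, pow_zero, one_mul, E_zero_self]
      exact X.id_mem x
    | succ l ih =>
      have h1 := X.comp_mem ih (hg (t ^ l * x))
      rw [gen_eq, E_comp, if_pos rfl, ← pow_succ'] at h1
      -- The target is made a variable because `t * (t ^ l * x)` and `t ^ (l + 1) * x` are only
      -- propositionally equal, and the type of the morphism depends on it.
      have : ∀ z, t * (t ^ l * x) = z → E x z (l + 1) ∈ X.piece (g ^ (l + 1)) x z := by
        rintro _ rfl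
        exact h1
      exact this _ (by rw [pow_succ', mul_assoc])
  · rw [E_of_ne h]
    exact zero_mem _

/-- The whole line of morphisms from `x` to `y` sits in the degree of the shortest path, so the
degree of a nonzero morphism depends on its endpoints only. -/
theorem mem_piece_iff [CommGroup Γ] {q : k} {hq : IsPrimitiveRoot q n}
    {X : HopfGrading (hopf hq) Γ} {g : Γ} (hg : HasGenDegree X.toLinGrading g)
    {x y : TaftCategory k n} {f : x ⟶ y} (hf : f ≠ 0) {s : Γ} :
    f ∈ X.piece s x y ↔ s = g ^ dist x y := by
  have h : f ∈ X.piece (g ^ dist x y) x y := mem_of_base_mem f (E_mem hg x y _)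
  exact ⟨fun h' => degree_unique X.toLinGrading hf h' h, fun h' => h' ▸ h⟩

/-! ### Walks, connectedness and the order of the grading group -/

/-- The number of generating morphisms in a walk, counted with signs. -/
noncomputable def walkLength : ∀ {x y : TaftCategory k n}, Walk (TaftCategory k n) x y → ℤ
  | _, _, Walk.nil _ => 0
  | _, _, Walk.cons (y := y) (z := z) w _ _ => walkLength w + dist y z
  | _, _, Walk.consInv (y := y) (z := z) w _ _ => walkLength w - dist z y

theorem t_zpow_walkLength {x y : TaftCategory k n} (w : Walk (TaftCategory k n) x y) :
    t ^ walkLength w * x = y := by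
  induction w with
  | nil => rw [walkLength, zpow_zero, one_mul]
  | @cons y z w f hf ih =>
    rw [walkLength, add_comm, zpow_add, mul_assoc, ih, zpow_natCast, t_pow_dist]
  | @consInv y z w f hf ih =>
    rw [walkLength, sub_eq_neg_add, zpow_add, mul_assoc, ih, zpow_neg, zpow_natCast,
      inv_mul_eq_iff_eq_mul, t_pow_dist]

/-- Every walk is homogeneous, and its degree is seen through one integer that does not depend on
the grading. -/
theorem hasDegree_iff [CommGroup Γ] {q : k} {hq : IsPrimitiveRoot q n}
    {X : HopfGrading (hopf hq) Γ} {g : Γ} (hg : HasGenDegree X.toLinGrading g)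
    {x y : TaftCategory k n} (w : Walk (TaftCategory k n) x y) (s : Γ) :
    X.HasDegree w s ↔ s = g ^ walkLength w := by
  induction w generalizing s with
  | nil => rw [walkLength, zpow_zero, LinGrading.HasDegree]
  | @cons y z w f hf ih =>
    simp only [LinGrading.HasDegree, mem_piece_iff hg hf, ih, walkLength]
    rw [add_comm, zpow_add, zpow_natCast]
    exact ⟨fun ⟨_, _, h1, h2, h⟩ => by rw [h, h1, h2], fun h => ⟨_, _, rfl, rfl, h⟩⟩
  | @consInv y z w f hf ih =>
    simp only [LinGrading.HasDegree, mem_piece_iff hg hf, ih, walkLength]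
    rw [sub_eq_neg_add, zpow_add, zpow_neg, zpow_natCast]
    exact ⟨fun ⟨_, _, h1, h2, h⟩ => by rw [h, h1, h2], fun h => ⟨_, _, rfl, rfl, h⟩⟩

/-- The length is computed from the objects visited, and `J` fixes them. -/
theorem walkLength_mapWalk {q : k} {hq : IsPrimitiveRoot q n} (J : HopfAutomorphism (hopf hq))
    {x y : TaftCategory k n} (w : Walk (TaftCategory k n) x y) :
    walkLength (J.mapWalk w) = walkLength w := by
  induction w with
  | nil => rw [HopfAutomorphism.mapWalk]
  | cons w f hf ih => rw [HopfAutomorphism.mapWalk, walkLength, walkLength, ih]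
  | consInv w f hf ih => rw [HopfAutomorphism.mapWalk, walkLength, walkLength, ih]

theorem exists_walk (hn : 2 ≤ n) {x y : TaftCategory k n} {j : ℤ} (h : t ^ j * x = y) :
    ∃ w : Walk (TaftCategory k n) x y, walkLength w = j := by
  induction j generalizing y with
  | zero =>
    obtain rfl : x = y := by rw [← h, zpow_zero, one_mul]
    exact ⟨Walk.nil x, by rw [walkLength]⟩
  | succ j ih =>
    obtain rfl : t * (t ^ (j : ℤ) * x) = y := by
      rw [← h, add_comm, zpow_add, zpow_one, mul_assoc]
    obtain ⟨w, hw⟩ := ih rfl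
    exact ⟨Walk.cons w (gen _) (gen_ne_zero hn _), by
      rw [walkLength, hw, dist_t_mul hn, Nat.cast_one]⟩
  | pred j ih =>
    -- The last step runs backwards along `gen y : y ⟶ t * y`, so the walk before it ends at `t *
    -- y`.
    obtain ⟨w, hw⟩ := ih (y := t * y) (by
      rw [← h, zpow_sub_one, ← mul_assoc, mul_comm _ t⁻¹, mul_inv_cancel_left])
    exact ⟨Walk.consInv w (gen _) (gen_ne_zero hn _), by
      rw [walkLength, hw, dist_t_mul hn, Nat.cast_one]⟩

/-- Walks from `x` to `y` have as lengths all the integers congruent to `dist x y` modulo `n`; their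
degrees form the coset of `⟨g ^ n⟩` containing `g ^ dist x y`. -/
theorem isConnected_iff [CommGroup Γ] {q : k} {hq : IsPrimitiveRoot q n} (hn : 2 ≤ n)
    {X : HopfGrading (hopf hq) Γ} {g : Γ} (hg : HasGenDegree X.toLinGrading g) :
    X.IsConnected ↔ ∀ s : Γ, s ∈ Subgroup.zpowers (g ^ n) := by
  constructor
  · intro h s
    obtain ⟨w, hw⟩ := h 1 1 s
    rw [hasDegree_iff hg] at hw
    have h1 := t_zpow_walkLength w
    rw [mul_one, t_zpow_eq_one_iff] at h1
    obtain ⟨j, hj⟩ := h1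
    exact ⟨j, by rw [hw, hj, zpow_mul, zpow_natCast]⟩
  · intro h x y s
    -- The factor `g ^ dist x y` of the shortest path is removed; the rest of `s` is made up by
    -- going `j` times around the crown.
    obtain ⟨j, hj⟩ := h ((g ^ dist x y)⁻¹ * s)
    have hy : t ^ (dist x y + n * j : ℤ) * x = y := by
      rw [zpow_add, (t_zpow_eq_one_iff _).2 (dvd_mul_right _ _), mul_one, zpow_natCast, t_pow_dist]
    obtain ⟨w, hw⟩ := exists_walk hn hy
    refine ⟨w, (hasDegree_iff hg w s).2 ?_⟩
    rw [hw, zpow_add, zpow_natCast, zpow_mul, zpow_natCast]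
    exact (mul_inv_cancel_left _ s).symm.trans (congrArg _ hj.symm)

/-- Writing `g` as a power of `g ^ n` gives `g ^ (n * j - 1) = 1`, with a nonzero exponent because
`n` does not divide `1`. The order of `Γ` divides this exponent, which is prime to `n`. -/
theorem finite_of_zpowers_pow [CommGroup Γ] (hn : 2 ≤ n) {g : Γ}
    (h : ∀ s : Γ, s ∈ Subgroup.zpowers (g ^ n)) : Finite Γ ∧ (Nat.card Γ).Coprime n := by
  obtain ⟨j, hj⟩ := h g
  have h1 : g ^ (n * j - 1 : ℤ) = 1 := by
    rw [zpow_sub_one, zpow_mul, zpow_natCast]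
    exact (congrArg (· * g⁻¹) hj).trans (mul_inv_cancel g)
  have hgen : ∀ s : Γ, s ∈ Subgroup.zpowers g := fun s => by
    obtain ⟨i, hi⟩ := h s
    exact ⟨n * i, by simpa only [zpow_mul, zpow_natCast] using hi⟩
  -- Both sides are `0` when `Γ` is infinite. Finiteness can thus be read off from the divisibility
  -- below: `0` does not divide a nonzero integer.
  have hcard : orderOf g = Nat.card Γ := orderOf_eq_card_of_forall_mem_zpowers hgen
  have hdvd : (Nat.card Γ : ℤ) ∣ n * j - 1 := by
    rw [← hcard]
    exact orderOf_dvd_iff_zpow_eq_one.2 h1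
  have hne : (n * j - 1 : ℤ) ≠ 0 := fun h0 => by
    have : (n : ℤ) ∣ 1 := ⟨j, by linarith⟩
    have := Int.le_of_dvd one_pos this
    omega
  refine ⟨Nat.finite_of_card_ne_zero fun h0 => hne ?_, ?_⟩
  · rw [h0] at hdvd
    exact zero_dvd_iff.1 hdvd
  · rw [← Nat.isCoprime_iff_coprime]
    obtain ⟨c, hc⟩ := hdvd
    -- The equation `n * j - 1 = card * c` is a Bézout relation.
    exact ⟨-c, j, by linarith⟩

/-! ### Every group element is the generator degree of a Hopf grading -/

/-- The homogeneous components of the grading with all the generating morphisms of degree `g`. -/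
noncomputable def stdPiece [Group Γ] (g s : Γ) (x y : TaftCategory k n) : Submodule k (x ⟶ y) :=
  open Classical in if s = g ^ dist x y then ⊤ else ⊥

theorem stdPiece_self [Group Γ] (g : Γ) (x y : TaftCategory k n) :
    stdPiece g (g ^ dist x y) x y = ⊤ := if_pos rfl

theorem stdPiece_of_ne [Group Γ] {g s : Γ} {x y : TaftCategory k n} (h : s ≠ g ^ dist x y) :
    stdPiece g s x y = ⊥ := if_neg h

/-- No relation on `g` is imposed, although `l` and `dist x y` may differ by a multiple of `n`: in
that case the path is too long and hence zero. This makes composition compatible with degrees for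
arbitrary `g`. -/
theorem E_mem_stdPiece [Group Γ] (g : Γ) (x y : TaftCategory k n) (l : ℕ) :
    E x y l ∈ stdPiece g (g ^ l) x y := by
  by_cases h1 : t ^ l * x = y
  · rcases le_or_gt n l with h2 | h2
    · rw [E_of_le x y h2]
      exact zero_mem _
    · rw [eq_dist h2 h1, stdPiece_self]
      trivial
  · rw [E_of_ne h1]
    exact zero_mem _

theorem eq_zero_or_of_mem_stdPiece [Group Γ] {g s : Γ} {x y : TaftCategory k n} {f : x ⟶ y}
    (h : f ∈ stdPiece g s x y) : f = 0 ∨ s = g ^ dist x y := by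
  by_cases h1 : s = g ^ dist x y
  · exact Or.inr h1
  · rw [stdPiece_of_ne h1] at h
    exact Or.inl ((Submodule.mem_bot k).1 h)

/-- The grading of the Taft category with all the generating morphisms of degree `g`. -/
noncomputable def stdGrading [CommGroup Γ] {q : k} (hq : IsPrimitiveRoot q n) (g : Γ) :
    HopfGrading (hopf hq) Γ where
  piece := stdPiece g
  isInternal := fun x y => by
    classical
    rw [DirectSum.isInternal_submodule_iff_iSupIndep_and_iSup_eq_top]
    constructor
    · intro s
      by_cases h : s = g ^ dist x y
      · have : ⨆ j, ⨆ (_ : j ≠ s), stdPiece g j x y = ⊥ := by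
          simp only [iSup_eq_bot]
          intro j hj
          exact stdPiece_of_ne (by rwa [← h])
        rw [this]
        exact disjoint_bot_right
      · beta_reduce
        rw [stdPiece_of_ne h]
        exact disjoint_bot_left
    · exact top_le_iff.1 (le_iSup_of_le (g ^ dist x y) (stdPiece_self g x y).ge)
  comp_mem := by
    intro x y z s s' f f' hf hf'
    rcases eq_zero_or_of_mem_stdPiece hf with rfl | rfl
    · rw [Limits.zero_comp]
      exact zero_mem _
    rcases eq_zero_or_of_mem_stdPiece hf' with rfl | rfl
    · rw [Limits.comp_zero]
      exact zero_mem _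
    obtain ⟨c, rfl⟩ := exists_smul_base f
    obtain ⟨c', rfl⟩ := exists_smul_base f'
    rw [Linear.smul_comp, Linear.comp_smul, base, base, E_comp, if_pos (t_pow_dist x y),
      mul_comm, ← pow_add]
    exact Submodule.smul_mem _ _ (Submodule.smul_mem _ _ (E_mem_stdPiece _ _ _ _))
  id_mem := fun x => by
    have := E_mem_stdPiece g x x 0
    rwa [pow_zero, E_zero_self] at this
  comul_mem := by
    intro x y a b c d hx hy s f hf
    rcases eq_zero_or_of_mem_stdPiece hf with rfl | rfl
    · rw [map_zero]
      exact zero_mem _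
    obtain ⟨r, rfl⟩ := exists_smul_base f
    rw [map_smul]
    refine Submodule.smul_mem _ _ ?_
    change comul hq hx hy (E x y _) ∈ _
    rw [comul_E, delta_eq_sum hq.pow_eq_one]
    refine Submodule.sum_mem _ fun i hi => Submodule.smul_mem _ _ ?_
    -- Each term of the comultiplication distributes the length of the path between the two tensor
    -- factors, so the two degrees multiply to `g ^ dist x y`.
    refine Submodule.mem_iSup_of_mem ⟨(g ^ i, g ^ (dist x y - i)), ?_⟩ ?_
    · rw [← pow_add, Nat.add_sub_cancel' (Nat.lt_succ_iff.1 (Finset.mem_range.1 hi))]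
    · exact ⟨(⟨_, E_mem_stdPiece g a c i⟩ : stdPiece g (g ^ i) a c) ⊗ₜ
        (⟨_, E_mem_stdPiece g b d (dist x y - i)⟩ :
          stdPiece g (g ^ (dist x y - i)) b d), rfl⟩
  counit_eq_zero := by
    intro x y s f hf hs
    rcases eq_zero_or_of_mem_stdPiece hf with rfl | rfl
    · rw [map_zero]
    obtain ⟨r, rfl⟩ := exists_smul_base f
    rw [map_smul]
    change r • counit (E x y _) = 0
    rw [counit_E, if_neg, smul_zero]
    -- The counit sees only paths of length `0`, whose degree is `g ^ 0 = 1`.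
    rintro ⟨-, -, h⟩
    exact hs (by rw [h, pow_zero])
  antipode_mem := by
    intro x y s f hf
    rcases eq_zero_or_of_mem_stdPiece hf with rfl | rfl
    · rw [map_zero]
      exact zero_mem _
    obtain ⟨r, rfl⟩ := exists_smul_base f
    rw [map_smul]
    refine Submodule.smul_mem _ _ ?_
    change antipode q (E x y _) ∈ _
    rw [antipode_E]
    exact Submodule.smul_mem _ _ (E_mem_stdPiece _ _ _ _)

theorem stdGrading_hasGenDegree [CommGroup Γ] {q : k} (hq : IsPrimitiveRoot q n) (g : Γ) :
    HasGenDegree (stdGrading hq g).toLinGrading g := by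
  intro u
  have := E_mem_stdPiece g u (t * u) 1
  rwa [pow_one, ← gen_eq] at this

end

/-! ### Morphisms of connected gradings and divisibility of orders -/

section
variable {k : Type*} [Field k] {n : ℕ} [NeZero n] {q : k} {hq : IsPrimitiveRoot q n}

/-- The trivial automorphism. -/
noncomputable def idAutomorphism (hq : IsPrimitiveRoot q n) : HopfAutomorphism (hopf hq) where
  map := LinearEquiv.refl k _
  map_id _ := rfl
  map_comp _ _ := rfl
  map_comul hx hy f := by
    change _ = TensorProduct.map LinearMap.id LinearMap.id _
    rw [TensorProduct.map_id]
    rfl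
  map_counit _ := rfl
  map_antipode _ := rfl

/-- Since automorphisms do not change lengths of walks, the choice of `J` is immaterial. The lengths
of closed walks are multiples of `n`, so the condition on all of them follows from that on length
`n`. -/
theorem isMorphism_iff (hn : 2 ≤ n) {X Y : ConnectedHopfGrading.{w} (hopf hq)} {g : X.Γ} {g' : Y.Γ}
    (hg : HasGenDegree X.grading.toLinGrading g) (hg' : HasGenDegree Y.grading.toLinGrading g')
    (μ : X.Γ →* Y.Γ) : X.IsMorphism Y μ ↔ μ (g ^ n) = g' ^ n := by
  constructor
  · rintro ⟨J, -, h⟩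
    obtain ⟨w, hw⟩ := exists_walk (k := k) hn (x := 1) (y := 1) (j := n)
      (by rw [mul_one, t_zpow_eq_one_iff])
    have h1 := h w (g ^ n) ((hasDegree_iff hg w _).2 (by rw [hw, zpow_natCast]))
    rw [hasDegree_iff hg', walkLength_mapWalk, hw, zpow_natCast] at h1
    exact h1
  · intro h
    -- The identity suffices: it is homogeneous for any two gradings because every morphism is
    -- homogeneous in every grading.
    refine ⟨idAutomorphism hq, fun x y s f _ => ?_, fun w s hs => ?_⟩
    · obtain ⟨s', hs'⟩ := exists_base_mem Y.grading.toLinGrading x y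
      exact ⟨s', mem_of_base_mem _ hs'⟩
    · have h1 := t_zpow_walkLength w
      rw [mul_one, t_zpow_eq_one_iff] at h1
      obtain ⟨j, hj⟩ := h1
      rw [hasDegree_iff hg] at hs
      rw [hasDegree_iff hg', walkLength_mapWalk, hs, hj, zpow_mul, zpow_mul, zpow_natCast,
        zpow_natCast, map_zpow, h]

/-- The common degree of the generating morphisms. -/
noncomputable def genDegree (hn : 2 ≤ n) (X : ConnectedHopfGrading.{w} (hopf hq)) : X.Γ :=
  (exists_hasGenDegree hq hn X.grading).choose

theorem hasGenDegree_genDegree (hn : 2 ≤ n) (X : ConnectedHopfGrading.{w} (hopf hq)) :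
    HasGenDegree X.grading.toLinGrading (genDegree hn X) :=
  (exists_hasGenDegree hq hn X.grading).choose_spec

/-- The degree of the closed walk `a_{t^{n-1}} ⋯ a_t a_1`. -/
noncomputable def loopDegree (hn : 2 ≤ n) (X : ConnectedHopfGrading.{w} (hopf hq)) : X.Γ :=
  genDegree hn X ^ n

theorem mem_zpowers_loopDegree (hn : 2 ≤ n) (X : ConnectedHopfGrading.{w} (hopf hq)) (s : X.Γ) :
    s ∈ Subgroup.zpowers (loopDegree hn X) :=
  (isConnected_iff hn (hasGenDegree_genDegree hn X)).1 X.connected s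

theorem orderOf_loopDegree (hn : 2 ≤ n) (X : ConnectedHopfGrading.{w} (hopf hq)) :
    orderOf (loopDegree hn X) = Nat.card X.Γ :=
  orderOf_eq_card_of_forall_mem_zpowers (mem_zpowers_loopDegree hn X)

theorem finite_and_coprime (hn : 2 ≤ n) (X : ConnectedHopfGrading.{w} (hopf hq)) :
    Finite X.Γ ∧ (Nat.card X.Γ).Coprime n :=
  finite_of_zpowers_pow hn (mem_zpowers_loopDegree hn X)

theorem isMorphism_iff_loopDegree (hn : 2 ≤ n) {X Y : ConnectedHopfGrading.{w} (hopf hq)}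
    (μ : X.Γ →* Y.Γ) : X.IsMorphism Y μ ↔ μ (loopDegree hn X) = loopDegree hn Y :=
  isMorphism_iff hn (hasGenDegree_genDegree hn X) (hasGenDegree_genDegree hn Y) μ

/-- The orders of the groups are the orders of the loop degrees, and the order of an image divides
the order of the element. -/
theorem card_dvd_of_isMorphism (hn : 2 ≤ n) {X Y : ConnectedHopfGrading.{w} (hopf hq)}
    {μ : X.Γ →* Y.Γ} (h : X.IsMorphism Y μ) : Nat.card Y.Γ ∣ Nat.card X.Γ := by
  rw [← orderOf_loopDegree hn X, ← orderOf_loopDegree hn Y,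
    ← (isMorphism_iff_loopDegree hn μ).1 h]
  exact orderOf_map_dvd μ _

/-- A cyclic group maps to another group by sending its generator to any element whose order divides
that of the generator; here the loop degree is sent to the loop degree. -/
theorem exists_isMorphism (hn : 2 ≤ n) {X Y : ConnectedHopfGrading.{w} (hopf hq)}
    (h : Nat.card Y.Γ ∣ Nat.card X.Γ) : ∃ μ : X.Γ →* Y.Γ, X.IsMorphism Y μ := by
  rw [← orderOf_loopDegree hn X, ← orderOf_loopDegree hn Y] at h
  exact ⟨monoidHomOfForallMemZpowers (mem_zpowers_loopDegree hn X) h,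
    (isMorphism_iff_loopDegree hn _).2 (monoidHomOfForallMemZpowers_apply_gen _ _)⟩

theorem exists_card_eq (hq : IsPrimitiveRoot q n) (hn : 2 ≤ n) {m : ℕ} (hm : m.Coprime n) :
    ∃ X : ConnectedHopfGrading.{w} (hopf hq), Nat.card X.Γ = m := by
  -- The integer `0` is prime to `n` only for `n = 1`. This also keeps an infinite group out of the
  -- inverse limit.
  have hm0 : m ≠ 0 := by
    rintro rfl
    rw [Nat.coprime_zero_left] at hm
    omega
  have : NeZero m := ⟨hm0⟩
  -- The lift places the cyclic group of order `m` in the universe of the grading groups; the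
  -- generators of the category get a generator `g` of it as degree, and `g ^ n` still generates
  -- because `m` is prime to `n`.
  let Γ := ULift.{w} (Multiplicative (ZMod m))
  let g : Γ := ULift.up (Multiplicative.ofAdd 1)
  have hcard : Nat.card Γ = m := by
    rw [Nat.card_congr Equiv.ulift, Nat.card_congr Multiplicative.toAdd, Nat.card_zmod]
  have hg : ∀ s : Γ, s ∈ Subgroup.zpowers g := by
    rintro ⟨s⟩
    refine ⟨((Multiplicative.toAdd s).val : ℤ), ?_⟩
    apply ULift.down_injective
    change Multiplicative.ofAdd (1 : ZMod m) ^ ((Multiplicative.toAdd s).val : ℤ) = s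
    rw [zpow_natCast, ← ofAdd_nsmul, nsmul_one, ZMod.natCast_zmod_val, ofAdd_toAdd]
  have hord : orderOf g = m := (orderOf_eq_card_of_forall_mem_zpowers hg).trans hcard
  have hgn : ∀ s : Γ, s ∈ Subgroup.zpowers (g ^ n) := by
    intro s
    have : orderOf (g ^ n) = Nat.card Γ := by
      rw [Nat.Coprime.orderOf_pow (by rwa [hord]), hord, hcard]
    have : Finite Γ := Nat.finite_of_card_ne_zero (by rwa [hcard])
    have h1 : Subgroup.zpowers (g ^ n) = ⊤ := Subgroup.eq_top_of_card_eq _ (by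
      rwa [Nat.card_zpowers])
    rw [h1]
    trivial
  exact ⟨⟨Γ, stdGrading hq g, (isConnected_iff hn (stdGrading_hasGenDegree hq g)).2 hgn⟩, hcard⟩

/-! ### The fundamental group as an inverse limit -/

theorem pow_zmod_val_add {M : Type*} [Monoid M] {h : M} {m : ℕ} [NeZero m] (hh : h ^ m = 1)
    (a b : ZMod m) : h ^ (a + b).val = h ^ a.val * h ^ b.val := by
  rw [ZMod.val_add, ← pow_add, ← pow_eq_pow_mod _ hh]

/-- This translates the projections of the inverse limit into powers: for an element killed by `m'`,
an exponent modulo `m` matters only modulo `m'`. -/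
theorem pow_zmod_val_castHom {M : Type*} [Monoid M] {h : M} {m m' : ℕ} [NeZero m]
    (hd : m' ∣ m) (hh : h ^ m' = 1) (a : ZMod m) :
    h ^ (ZMod.castHom hd (ZMod m') a).val = h ^ a.val := by
  have : ZMod.castHom hd (ZMod m') a = (a.val : ZMod m') := by
    conv_lhs => rw [← ZMod.natCast_zmod_val a, map_natCast]
  rw [this, ZMod.val_natCast, ← pow_eq_pow_mod _ hh]

instance (X : ConnectedHopfGrading.{w} (hopf hq)) [Finite X.Γ] : NeZero (Nat.card X.Γ) :=
  ⟨Nat.card_pos.ne'⟩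

theorem loopDegree_pow_card (hn : 2 ≤ n) (X : ConnectedHopfGrading.{w} (hopf hq)) :
    loopDegree hn X ^ Nat.card X.Γ = 1 := pow_card_eq_one'

/-- The index of the inverse limit given by the order of a grading group. -/
noncomputable def cardIndex (hn : 2 ≤ n) (X : ConnectedHopfGrading.{w} (hopf hq)) :
    {m : ℕ // m.Coprime n} := ⟨Nat.card X.Γ, (finite_and_coprime hn X).2⟩

/-- The compatible family of elements of the grading groups given by an element of the inverse
limit. -/
noncomputable def ofLimit (hq : IsPrimitiveRoot q n) (hn : 2 ≤ n) :
    Multiplicative (coprimeLimit n) →* hopfFundamentalGroup.{w} (hopf hq) :=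
  MonoidHom.mk' (fun x => ⟨fun X => loopDegree hn X.1 ^
    ((Multiplicative.toAdd x).1 (cardIndex hn X.1)).val, by
      intro X Y μ h
      have := X.2
      have : NeZero (cardIndex hn X.1).1 := inferInstanceAs (NeZero (Nat.card X.1.Γ))
      have hd := card_dvd_of_isMorphism hn h
      -- After `μ`, the exponent at `X` sits on the loop degree of `Y`, whose order divides that of
      -- `Γ_X`; compatibility in the limit says that this exponent reduces to the one at `Y`.
      rw [map_pow, (isMorphism_iff_loopDegree hn μ).1 h]
      beta_reduce
      rw [← (Multiplicative.toAdd x).2 (cardIndex hn X.1) (cardIndex hn Y.1) hd]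
      exact (pow_zmod_val_castHom hd (loopDegree_pow_card hn Y.1) _).symm⟩) fun x y => by
    ext X
    have := X.2
    have : NeZero (cardIndex hn X.1).1 := inferInstanceAs (NeZero (Nat.card X.1.Γ))
    exact pow_zmod_val_add (loopDegree_pow_card hn X.1) _ _

/-- The loop degree has order exactly the index `m`, and the canonical representatives lie below
`m`. -/
theorem loopDegree_pow_val_injective (hn : 2 ≤ n) (X : ConnectedHopfGrading.{w} (hopf hq))
    {a b : ZMod (cardIndex hn X).1} (h : loopDegree hn X ^ a.val = loopDegree hn X ^ b.val) :
    a = b := by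
  have := (finite_and_coprime hn X).1
  have : NeZero (cardIndex hn X).1 := inferInstanceAs (NeZero (Nat.card X.Γ))
  rw [pow_inj_mod, orderOf_loopDegree] at h
  have hlt := fun c : ZMod (cardIndex hn X).1 => Nat.mod_eq_of_lt (ZMod.val_lt c)
  exact ZMod.val_injective _ ((hlt a).symm.trans (h.trans (hlt b)))

theorem exists_loopDegree_pow_val (hn : 2 ≤ n) (X : ConnectedHopfGrading.{w} (hopf hq)) (s : X.Γ) :
    ∃ a : ZMod (cardIndex hn X).1, loopDegree hn X ^ a.val = s := by
  have := (finite_and_coprime hn X).1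
  obtain ⟨j, rfl⟩ := Submonoid.mem_powers_iff _ _ |>.1
    ((mem_powers_iff_mem_zpowers).2 (mem_zpowers_loopDegree hn X s))
  refine ⟨(j : ZMod (cardIndex hn X).1), ?_⟩
  rw [ZMod.val_natCast]
  exact (pow_eq_pow_mod _ (loopDegree_pow_card hn X)).symm

theorem exists_cardIndex_eq (hq : IsPrimitiveRoot q n) (hn : 2 ≤ n) (m : {m : ℕ // m.Coprime n}) :
    ∃ X : {X : ConnectedHopfGrading.{w} (hopf hq) // Finite X.Γ}, cardIndex hn X.1 = m := by
  obtain ⟨X, hX⟩ := exists_card_eq.{w} hq hn m.2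
  exact ⟨⟨X, (finite_and_coprime hn X).1⟩, Subtype.ext hX⟩

/-- Each index `m` is the order of some connected grading, and the value there recovers the
coordinate at `m`. -/
theorem ofLimit_injective (hq : IsPrimitiveRoot q n) (hn : 2 ≤ n) :
    Function.Injective (ofLimit.{w} hq hn) := by
  intro x y h
  apply Multiplicative.toAdd.injective
  apply Subtype.ext
  funext m
  obtain ⟨X, rfl⟩ := exists_cardIndex_eq.{w} hq hn m
  exact loopDegree_pow_val_injective hn X.1 (congrFun (congrArg Subtype.val h) X)

/-- The exponent of `γ X` with respect to the loop degree depends only on the order of `Γ_X`, since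
two gradings of equal order are linked by a morphism. Morphisms between different orders make these
exponents compatible. -/
theorem ofLimit_surjective (hq : IsPrimitiveRoot q n) (hn : 2 ≤ n) :
    Function.Surjective (ofLimit.{w} hq hn) := by
  intro γ
  have key : ∀ m : {m : ℕ // m.Coprime n}, ∃ a : ZMod m,
      -- Taking `a.val` as exponent lets one residue `a` modulo `m` serve all gradings of order `m`
      -- without transport between types `ZMod`.
      ∀ X : {X : ConnectedHopfGrading.{w} (hopf hq) // Finite X.Γ}, m.1 = Nat.card X.1.Γ →
        loopDegree hn X.1 ^ a.val = γ.1 X := by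
    intro m
    obtain ⟨X, rfl⟩ := exists_cardIndex_eq.{w} hq hn m
    obtain ⟨a, ha⟩ := exists_loopDegree_pow_val hn X.1 (γ.1 X)
    refine ⟨a, fun Y hY => ?_⟩
    obtain ⟨μ, hμ⟩ := exists_isMorphism hn (X := X.1) (Y := Y.1) (dvd_of_eq hY.symm)
    rw [← γ.2 X Y μ hμ, ← ha, map_pow, (isMorphism_iff_loopDegree hn μ).1 hμ]
  choose x hx using key
  refine ⟨Multiplicative.ofAdd ⟨x, fun m m' hd => ?_⟩, ?_⟩
  · obtain ⟨X, rfl⟩ := exists_cardIndex_eq.{w} hq hn m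
    obtain ⟨Y, rfl⟩ := exists_cardIndex_eq.{w} hq hn m'
    have := X.2
    have : NeZero (cardIndex hn X.1).1 := inferInstanceAs (NeZero (Nat.card X.1.Γ))
    -- The congruence of exponents is tested on powers of the loop degree of `Y`; there it becomes
    -- the compatibility of `γ` with the morphism from `X` to `Y`.
    apply loopDegree_pow_val_injective hn Y.1
    refine (pow_zmod_val_castHom hd (loopDegree_pow_card hn Y.1) _).trans ?_
    rw [hx (cardIndex hn Y.1) Y rfl]
    obtain ⟨μ, hμ⟩ := exists_isMorphism hn (X := X.1) (Y := Y.1) hd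
    rw [← γ.2 X Y μ hμ, ← hx (cardIndex hn X.1) X rfl, map_pow,
      (isMorphism_iff_loopDegree hn μ).1 hμ]
  · apply Subtype.ext
    funext X
    exact hx (cardIndex hn X.1) X rfl

/-- The order of a universal grading group would be divisible by every `m` prime to `n`, but such
`m` are unbounded. -/
theorem not_exists_isUniversal (hq : IsPrimitiveRoot q n) (hn : 2 ≤ n) :
    ¬ ∃ V : ConnectedHopfGrading.{w} (hopf hq), V.IsUniversal := by
  rintro ⟨V, hV⟩
  have := (finite_and_coprime hn V).1
  have hpos : 0 < Nat.card V.Γ := Nat.card_pos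
  -- This order is prime to `n`, being `1` modulo `n`, and exceeds the order of `V.Γ`.
  obtain ⟨Y, hY⟩ := exists_card_eq.{w} hq hn (m := n * Nat.card V.Γ + 1) (by simp)
  obtain ⟨μ, hμ, -⟩ := hV Y
  have h := Nat.le_of_dvd hpos (card_dvd_of_isMorphism hn hμ)
  rw [hY] at h
  nlinarith

end

end TaftCategory

theorem mainTheorem7 {k : Type u} [Field k] (n : ℕ) [NeZero n] (hn : 2 ≤ n) (q : k)
    (hq : IsPrimitiveRoot q n) :
    -- The grading groups are cyclic of order coprime to `n`, the generators share their degree.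
    (∀ X : ConnectedHopfGrading.{w} (TaftCategory.hopf hq),
      (∃ g : X.Γ, ∀ u : TaftCategory k n,
        TaftCategory.gen u ∈ X.grading.piece g u (TaftCategory.t * u)) ∧
      IsCyclic X.Γ ∧ Finite X.Γ ∧ (Nat.card X.Γ).Coprime n) ∧
    -- There is no universal Hopf grading.
    (¬ ∃ V : ConnectedHopfGrading.{w} (TaftCategory.hopf hq), V.IsUniversal) ∧
    -- The fundamental group is the inverse limit.
    ∃ e : hopfFundamentalGroup.{w} (TaftCategory.hopf hq) ≃* Multiplicative (coprimeLimit n),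
      ∀ (γ : hopfFundamentalGroup.{w} (TaftCategory.hopf hq))
        (X : {X : ConnectedHopfGrading.{w} (TaftCategory.hopf hq) // Finite X.Γ}) (g : X.1.Γ)
        (hX : (Nat.card X.1.Γ).Coprime n),
        (∀ u : TaftCategory k n,
          TaftCategory.gen u ∈ X.1.grading.piece g u (TaftCategory.t * u)) →
        γ.1 X = (g ^ n) ^ ((Multiplicative.toAdd (e γ)).1 ⟨Nat.card X.1.Γ, hX⟩).val := by
  refine ⟨fun X => ⟨TaftCategory.exists_hasGenDegree hq hn X.grading,
    ⟨TaftCategory.loopDegree hn X, TaftCategory.mem_zpowers_loopDegree hn X⟩,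
    TaftCategory.finite_and_coprime hn X⟩, TaftCategory.not_exists_isUniversal hq hn,
    (MulEquiv.ofBijective (TaftCategory.ofLimit.{w} hq hn)
      ⟨TaftCategory.ofLimit_injective hq hn, TaftCategory.ofLimit_surjective hq hn⟩).symm, ?_⟩
  intro γ X g hX hg
  -- The degree `g` is the chosen `genDegree`, so `g ^ n` is the loop degree. As the isomorphism is
  -- the inverse of `ofLimit`, the formula is the value at `X` of `ofLimit` applied to `e γ`.
  obtain rfl := TaftCategory.HasGenDegree.unique hn hg
    (TaftCategory.hasGenDegree_genDegree hn X.1)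
  exact congrArg (fun γ' : hopfFundamentalGroup.{w} (TaftCategory.hopf hq) => γ'.1 X)
    ((MulEquiv.ofBijective (TaftCategory.ofLimit.{w} hq hn)
      ⟨TaftCategory.ofLimit_injective hq hn,
        TaftCategory.ofLimit_surjective hq hn⟩).apply_symm_apply γ).symm
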